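/- All digraphs are finite, without loops and without multiple arcs. The degree of a vertex is the sum of its out-degree and its in-degree; cycles are simple and directed, have length at least $2$, and their length is the number of their arcs. A digraph is strongly connected if for every two distinct vertices $x,y$ there are a directed path from $x$ to $y$ and one from $y$ to $x$; it is $2$-strongly connected if it has at least $3$ vertices and is strongly connected and remains so after the deletion of any one vertex. For $a,b\ge 0$, $K^*_{a,b}$ denotes the complete bipartite digraph with partite sets of sizes $a$ and $b$, in which $xy$ and $yx$ are both arcs whenever $x$ and $y$ lie in different partite sets (and there are no other arcs). Let $D$ be a strongly connected non-Hamiltonian digraph of order $p$ in which every vertex has degree at least $p-1$, and let $m$ be the length of a longest cycle in $D$ (assumed to have at least one cycle; this only excludes the one-vertex digraph and the empty one). Then: (i) $D$ contains a cycle of length $r$ for every integer $r\in[2,m]$, unless $p$ is odd and $D$ is isomorphic to $K^*_{\lfloor p/2\rfloor,\lfloor p/2\rfloor+1}$. (ii) If $D$ is $2$-strongly connected, then for every longest cycle $C_m$ of $D$ the subdigraph of $D$ induced by $V(D)\setminus V(C_m)$ is a transitive tournament, that is, there is exactly one arc between any two distinct vertices of it, and its arc relation is transitive. -/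

import Mathlib

/-!  Finite digraphs without loops: degrees, cycles, strong connectivity, tournaments.
Mathlib's `Digraph V` already excludes multiple arcs. -/

namespace Digraph

variable {V : Type*}

/-- No vertex has an arc to itself. -/
def Loopless (D : Digraph V) : Prop :=
  ∀ x, ¬ D.Adj x x

/-- The degree of `x`: the number of out-neighbours plus the number of in-neighbours. -/
noncomputable def degree (D : Digraph V) (x : V) : ℕ :=
  {y | D.Adj x y}.ncard + {y | D.Adj y x}.ncard

/-- The subdigraph induced by a set of vertices. -/
def induce (D : Digraph V) (s : Set V) : Digraph s where
  Adj x y := D.Adj x y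

/-- A simple directed cycle `x₁ x₂ … xₘ x₁` with `m ≥ 2`: a cyclically ordered family of at least
two distinct vertices, each of which dominates its successor. Its length (the number of arcs)
is `c.length`. -/
def IsCycle (D : Digraph V) (c : Cycle V) : Prop :=
  2 ≤ c.length ∧ c.Nodup ∧ c.Chain D.Adj

/-- `D` contains a cycle of length `k`. -/
def HasCycleOfLength (D : Digraph V) (k : ℕ) : Prop :=
  ∃ c : Cycle V, D.IsCycle c ∧ c.length = k

/-- `D` contains a cycle through all of its vertices. -/
def IsHamiltonian (D : Digraph V) : Prop :=
  ∃ c : Cycle V, D.IsCycle c ∧ ∀ x, x ∈ c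

/-- `c` is a cycle of maximum length in `D`. -/
def IsLongestCycle (D : Digraph V) (c : Cycle V) : Prop :=
  D.IsCycle c ∧ ∀ c' : Cycle V, D.IsCycle c' → c'.length ≤ c.length

/-- Every vertex is reachable from every other one along arcs. -/
def StronglyConnected (D : Digraph V) : Prop :=
  ∀ x y, x ≠ y → Relation.ReflTransGen D.Adj x y

/-- `D` is `k`-strongly connected (for `k ≥ 1`): it has at least `k + 1` vertices and remains
strongly connected after the deletion of any set of at most `k - 1` vertices. -/
def KStronglyConnected [Fintype V] (D : Digraph V) (k : ℕ) : Prop :=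
  k + 1 ≤ Fintype.card V ∧
    ∀ A : Finset V, A.card < k → (D.induce {x | x ∉ A}).StronglyConnected

/-- A tournament: no loops, and exactly one arc between any two distinct vertices. -/
def IsTournament (D : Digraph V) : Prop :=
  D.Loopless ∧ ∀ x y, x ≠ y → Xor (D.Adj x y) (D.Adj y x)

/-- A tournament whose arc relation is transitive. -/
def IsTransitiveTournament (D : Digraph V) : Prop :=
  D.IsTournament ∧ ∀ x y z, D.Adj x y → D.Adj y z → D.Adj x z

/-- Isomorphism of digraphs: a bijection of the vertices preserving arcs in both directions. -/
def Isomorphic {W : Type*} (D : Digraph V) (E : Digraph W) : Prop :=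
  Nonempty (D.Adj ≃r E.Adj)

end Digraph

/-!
Let `C` be a longest cycle, of length `m`, and let `R` be the set of the remaining vertices. The
proof analyses the equality case of the argument of Bondy and Thomassen for Meyniel's theorem.

A *bypass* of `C` is a walk that leaves `C`, runs through `R` and returns to a different vertex of
`C`. If there is no bypass at all, then `D` has a clique containing `C`
(`hasCycle_of_not_onBypass`), and all lengths up to `m` occur. Otherwise choose a vertex `y` of `R`
and a bypass through `y` that skips as few vertices of `C` as possible; let `B` be the set of skipped
vertices, `Q` the rest of the cycle (a path) and `A` the strong component of `y` in `R`. No walk of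
length two through `R` joins `A` and `B`, and neither a vertex of `A` nor, by multiple insertion, a
vertex of `B` can be inserted into `Q`. Adding up the degrees of a vertex of `A` and a vertex of `B`
gives at most `2p - 2`; since all degrees are at least `p - 1`, every estimate used is an equality.
As a result (`exists_twinBlocks`) `A` and `B` are cliques of the same size, without arcs between
them, both attached to `Q` without gaps, and every other vertex of `R` is joined to `A ∪ B` by arcs
of one direction only.

If `A` has at least two vertices, the way it is attached to `Q = q a, …, q b` is determined by a
threshold `t`: it dominates `q a, …, q t` and is dominated by `q t, …, q b`
(`TwinBlocks.exists_isThreshold`). Cycles of all lengths can be read off (`TwinBlocks.hasCycle`), and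
the larger of the thresholds of `A` and `B` gives a cut vertex (`TwinBlocks.not_kStronglyConnected`).
So in a 2-strongly connected digraph every strong component of `R` is a single vertex, with exactly
one arc to any other vertex of `R`; that is, `R` induces a transitive tournament.

If `A = {y}`, then for each `i` exactly one of the arcs from `x i` to `y` and from `y` to `x (i + 1)`
exists, where `x` is the cycle, and `y` can be exchanged with certain vertices of the cycle. If the
length `e + 1` is missing, the set of `i` such that `y` dominates `x i` is invariant under the shift
by `e`. Cycles through two exchangeable vertices (`shift_or_shift`) then show that for some choice of
`C` and `y` this set consists of every second index (`IsHub.exists_even`). The vertices at the other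
positions have the same neighbours as `y`, the vertices dominated by `y` are pairwise non-adjacent,
and `R = {y}`, so `D` is complete bipartite (`IsHub.isomorphic`).
-/

set_option linter.unusedSectionVars false

/-! ### Paths with a prescribed vertex set -/

namespace Digraph

section Paths

variable {V : Type*} [DecidableEq V] {D : Digraph V}

/-- `D.PathOn u v s`: some directed path from `u` to `v` has exactly `s` as its set of vertices.
Since only the ends and the vertex set are recorded, lengths of paths and of the cycles obtained by
closing them are cardinalities of `s`. -/
inductive PathOn (D : Digraph V) : V → V → Finset V → Prop
  | single (u : V) : PathOn D u u {u}
  | cons {u v w : V} {s : Finset V} (huv : D.Adj u v) (hs : PathOn D v w s) (hu : u ∉ s) :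
      PathOn D u w (insert u s)

theorem PathOn.left_mem {u v : V} {s : Finset V} (h : D.PathOn u v s) : u ∈ s := by
  cases h <;> simp

theorem PathOn.right_mem {u v : V} {s : Finset V} (h : D.PathOn u v s) : v ∈ s := by
  induction h with
  | single u => simp
  | cons _ _ _ ih => exact Finset.mem_insert_of_mem ih

theorem PathOn.append {u v w z : V} {s t : Finset V} (h : D.PathOn u v s) (hvw : D.Adj v w)
    (h' : D.PathOn w z t) (hst : Disjoint s t) : D.PathOn u z (s ∪ t) := by
  induction h with
  | single u =>
    rw [← Finset.insert_eq]
    exact .cons hvw h' (by simpa using hst)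
  | cons huv _ hu ih =>
    rw [Finset.insert_union]
    rw [Finset.disjoint_insert_left] at hst
    exact .cons huv (ih hvw hst.2) (by simp [hu, hst.1])

/-- Cutting a path at one of its vertices. -/
theorem PathOn.exists_from {u v w : V} {s : Finset V} (h : D.PathOn u v s) (hw : w ∈ s) :
    ∃ t ⊆ s, D.PathOn w v t := by
  induction h with
  | single u =>
    obtain rfl : w = u := by simpa using hw
    exact ⟨_, subset_rfl, .single w⟩
  | cons huv hs hu ih =>
    rcases Finset.mem_insert.1 hw with rfl | hw
    · exact ⟨_, subset_rfl, .cons huv hs hu⟩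
    · obtain ⟨t, ht, hp⟩ := ih hw
      exact ⟨t, ht.trans (Finset.subset_insert _ _), hp⟩

theorem PathOn.exists_list {u v : V} {s : Finset V} (h : D.PathOn u v s) :
    ∃ l : List V, (u :: l).Nodup ∧ (u :: l).IsChain D.Adj ∧ (u :: l).getLast (by simp) = v ∧
      (u :: l).toFinset = s := by
  induction h with
  | single u => exact ⟨[], by simp⟩
  | @cons u v w s huv hs hu ih =>
    obtain ⟨l, h1, h2, h3, h4⟩ := ih
    refine ⟨v :: l, ?_, ?_, ?_, ?_⟩
    · rw [List.nodup_cons]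
      exact ⟨fun h => hu (by rw [← h4]; simpa using h), h1⟩
    · exact List.IsChain.cons_cons huv h2
    · rw [List.getLast_cons (by simp)]; exact h3
    · rw [List.toFinset_cons, h4]

/-- Closing a path by an arc gives a cycle. -/
theorem PathOn.hasCycle {u v : V} {s : Finset V} (h : D.PathOn u v s) (hvu : D.Adj v u)
    (hs : 2 ≤ s.card) : D.HasCycleOfLength s.card := by
  obtain ⟨l, h1, h2, h3, h4⟩ := h.exists_list
  have hlen : (u :: l).length = s.card := by rw [← h4, List.toFinset_card_of_nodup h1]
  refine ⟨((u :: l : List V) : Cycle V), ⟨by simpa [hlen] using hs, h1, ?_⟩, hlen⟩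
  rw [Cycle.chain_coe_cons, ← List.cons_append]
  refine List.IsChain.append h2 (by simp) ?_
  intro x hx y hy
  rw [List.getLast?_eq_getLast_of_ne_nil (by simp), h3] at hx
  simp at hx hy
  subst hx; subst hy; exact hvu

/-! ### Walks inside a set -/

/-- `D.WalkIn S u v`: there is a walk from `u` to `v` whose arcs join vertices of `S`
(the trivial walk at any vertex is allowed). -/
def WalkIn (D : Digraph V) (S : Set V) : V → V → Prop :=
  Relation.ReflTransGen fun a b => a ∈ S ∧ b ∈ S ∧ D.Adj a b

theorem WalkIn.trans {S : Set V} {a b c : V} (h : D.WalkIn S a b) (h' : D.WalkIn S b c) :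
    D.WalkIn S a c :=
  Relation.ReflTransGen.trans h h'

theorem WalkIn.mono {S S' : Set V} (hS : S ⊆ S') {a b : V} (h : D.WalkIn S a b) :
    D.WalkIn S' a b :=
  Relation.ReflTransGen.mono (fun _ _ h => ⟨hS h.1, hS h.2.1, h.2.2⟩) _ _ h

theorem WalkIn.arc {S : Set V} {a b : V} (ha : a ∈ S) (hb : b ∈ S) (h : D.Adj a b) :
    D.WalkIn S a b :=
  Relation.ReflTransGen.single ⟨ha, hb, h⟩

theorem WalkIn.mem {S : Set V} {a b : V} (h : D.WalkIn S a b) (ha : a ∈ S) : b ∈ S := by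
  rcases Relation.ReflTransGen.cases_tail h with h | ⟨c, _, h⟩
  · exact h ▸ ha
  · exact h.2.1

theorem WalkIn.exists_pathOn {S : Set V} {a b : V} (h : D.WalkIn S a b) (hb : b ∈ S) :
    ∃ s : Finset V, (↑s : Set V) ⊆ S ∧ D.PathOn a b s := by
  unfold WalkIn at h
  induction h using Relation.ReflTransGen.head_induction_on with
  | refl => exact ⟨{b}, by simpa using hb, .single b⟩
  | @head a c hac _ ih =>
    obtain ⟨s, hs, hp⟩ := ih
    by_cases ha : a ∈ s
    · obtain ⟨t, ht, hp'⟩ := hp.exists_from ha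
      exact ⟨t, fun x hx => hs (ht hx), hp'⟩
    · refine ⟨insert a s, ?_, .cons hac.2.2 hp ha⟩
      rw [Finset.coe_insert]
      exact Set.insert_subset hac.1 hs

/-- A walk leaving a set has a last vertex in it. -/
theorem exists_last_exit {r : V → V → Prop} {P : V → Prop} {a b : V}
    (h : Relation.ReflTransGen r a b) (ha : P a) (hb : ¬ P b) :
    ∃ u v, P u ∧ ¬ P v ∧ r u v ∧ Relation.ReflTransGen (fun a b => ¬ P a ∧ ¬ P b ∧ r a b) v b := by
  induction h with
  | refl => exact absurd ha hb
  | @tail c d _ hcd ih =>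
    by_cases hc : P c
    · exact ⟨c, d, hc, hb, hcd, .refl⟩
    · obtain ⟨u, v, hu, hv, huv, hw⟩ := ih hc
      exact ⟨u, v, hu, hv, huv, hw.tail ⟨hc, hb, hcd⟩⟩

/-- A walk into a set has a first vertex in it. -/
theorem exists_first_entry {r : V → V → Prop} {P : V → Prop} {a b : V}
    (h : Relation.ReflTransGen r a b) (ha : ¬ P a) (hb : P b) :
    ∃ u v, ¬ P u ∧ P v ∧ r u v ∧ Relation.ReflTransGen (fun a b => ¬ P a ∧ ¬ P b ∧ r a b) a u := by
  induction h using Relation.ReflTransGen.head_induction_on with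
  | refl => exact absurd hb ha
  | @head a c hac _ ih =>
    by_cases hc : P c
    · exact ⟨a, c, ha, hc, hac, .refl⟩
    · obtain ⟨u, v, hu, hv, huv, hw⟩ := ih hc
      exact ⟨u, v, hu, hv, huv, hw.head ⟨ha, hc, hac⟩⟩

/-! ### Cliques -/

/-- Any two distinct vertices of `s` are joined by arcs in both directions. -/
def IsCompleteOn (D : Digraph V) (s : Finset V) : Prop :=
  ∀ u ∈ s, ∀ v ∈ s, u ≠ v → D.Adj u v

theorem IsCompleteOn.mono {s t : Finset V} (h : D.IsCompleteOn s) (hts : t ⊆ s) :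
    D.IsCompleteOn t :=
  fun u hu v hv => h u (hts hu) v (hts hv)

theorem IsCompleteOn.pathOn {s : Finset V} (h : D.IsCompleteOn s) {u v : V} (hu : u ∈ s)
    (hv : v ∈ s) (huv : u ≠ v) : D.PathOn u v s := by
  induction hn : s.card generalizing s u with
  | zero => simp [Finset.card_eq_zero.1 hn] at hu
  | succ n ih =>
    by_cases hex : ∃ w ∈ s, w ≠ u ∧ w ≠ v
    · obtain ⟨w, hw, hwu, hwv⟩ := hex
      have := ih (s := s.erase u) (h.mono (s.erase_subset u)) (u := w)
        (Finset.mem_erase.2 ⟨hwu, hw⟩) (Finset.mem_erase.2 ⟨huv.symm, hv⟩) hwv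
        (by rw [Finset.card_erase_of_mem hu, hn]; rfl)
      have := PathOn.cons (h u hu w hw hwu.symm) this (s.notMem_erase u)
      rwa [Finset.insert_erase hu] at this
    · push Not at hex
      have hs : s = insert u {v} := by
        ext w
        simp only [Finset.mem_insert, Finset.mem_singleton]
        constructor
        · intro hw
          by_cases hwu : w = u
          · exact .inl hwu
          · exact .inr (hex w hw hwu)
        · rintro (rfl | rfl) <;> assumption
      rw [hs]
      exact .cons (h u hu v hv huv) (.single v) (by simpa using huv)

theorem IsCompleteOn.exists_pathOn {s : Finset V} (h : D.IsCompleteOn s) (hs : s.Nonempty) :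
    ∃ u ∈ s, ∃ v ∈ s, D.PathOn u v s := by
  obtain ⟨u, hu⟩ := hs
  by_cases hex : ∃ v ∈ s, u ≠ v
  · obtain ⟨v, hv, huv⟩ := hex
    exact ⟨u, hu, v, hv, h.pathOn hu hv huv⟩
  · push Not at hex
    have hs : s = {u} := by
      ext w
      simp only [Finset.mem_singleton]
      exact ⟨fun hw => (hex w hw).symm, fun hw => hw ▸ hu⟩
    exact ⟨u, hu, u, hu, hs ▸ .single u⟩

theorem IsCompleteOn.hasCycle {s : Finset V} (h : D.IsCompleteOn s) {r : ℕ} (hr : 2 ≤ r)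
    (hrs : r ≤ s.card) : D.HasCycleOfLength r := by
  obtain ⟨t, hts, rfl⟩ := Finset.exists_subset_card_eq hrs
  obtain ⟨u, hu, v, hv, huv⟩ := Finset.one_lt_card.1 hr
  exact ((h.mono hts).pathOn hu hv huv).hasCycle (h v (hts hv) u (hts hu) huv.symm) hr

/-! ### Lines and cycles indexed by the integers -/

/-- `q a, q (a + 1), …, q b` is a directed path. -/
structure IsLine (D : Digraph V) (q : ℤ → V) (a b : ℤ) : Prop where
  inj : ∀ i j, a ≤ i → i ≤ b → a ≤ j → j ≤ b → q i = q j → i = j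
  adj : ∀ i, a ≤ i → i < b → D.Adj (q i) (q (i + 1))

/-- The set of vertices `q i, …, q j`. -/
noncomputable def seg (q : ℤ → V) (i j : ℤ) : Finset V := (Finset.Icc i j).image q

theorem mem_seg {q : ℤ → V} {i j : ℤ} {v : V} : v ∈ seg q i j ↔ ∃ k, i ≤ k ∧ k ≤ j ∧ q k = v := by
  simp [seg, and_assoc]

theorem mem_seg_of {q : ℤ → V} {i j k : ℤ} (h1 : i ≤ k) (h2 : k ≤ j) : q k ∈ seg q i j :=
  mem_seg.2 ⟨k, h1, h2, rfl⟩

theorem seg_subset (q : ℤ → V) {i j i' j' : ℤ} (h1 : i' ≤ i) (h2 : j ≤ j') :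
    seg q i j ⊆ seg q i' j' := by
  intro v hv
  obtain ⟨k, hk, hk', rfl⟩ := mem_seg.1 hv
  exact mem_seg_of (h1.trans hk) (hk'.trans h2)

theorem IsLine.mem_seg_iff {q : ℤ → V} {a b : ℤ} (h : D.IsLine q a b) {i j k : ℤ} (hi : a ≤ i)
    (hj : j ≤ b) (hk : a ≤ k) (hk' : k ≤ b) : q k ∈ seg q i j ↔ i ≤ k ∧ k ≤ j := by
  constructor
  · intro hm
    obtain ⟨l, h1, h2, h3⟩ := mem_seg.1 hm
    obtain rfl := h.inj l k (hi.trans h1) (h2.trans hj) hk hk' h3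
    exact ⟨h1, h2⟩
  · exact fun hm => mem_seg_of hm.1 hm.2

theorem IsLine.seg_disjoint {q : ℤ → V} {a b : ℤ} (h : D.IsLine q a b) {i j i' j' : ℤ}
    (hi : a ≤ i) (hj' : j' ≤ b) (hlt : j < i') :
    Disjoint (seg q i j) (seg q i' j') := by
  rw [Finset.disjoint_left]
  intro v hv hv'
  obtain ⟨k, hk, hk', rfl⟩ := mem_seg.1 hv
  obtain ⟨l, hl, hl', he⟩ := mem_seg.1 hv'
  have := h.inj l k (by lia) (by lia) (by lia) (by lia) he
  lia

theorem IsLine.card_seg {q : ℤ → V} {a b : ℤ} (h : D.IsLine q a b) {i j : ℤ} (hi : a ≤ i)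
    (hj : j ≤ b) : (seg q i j).card = (j + 1 - i).toNat := by
  rw [seg, Finset.card_image_of_injOn, Int.card_Icc]
  intro x hx y hy hxy
  simp only [Finset.coe_Icc, Set.mem_Icc] at hx hy
  exact h.inj x y (by lia) (by lia) (by lia) (by lia) hxy

theorem IsLine.pathOn {q : ℤ → V} {a b : ℤ} (h : D.IsLine q a b) {i j : ℤ} (hi : a ≤ i)
    (hij : i ≤ j) (hj : j ≤ b) : D.PathOn (q i) (q j) (seg q i j) := by
  induction j, hij using Int.leInduction with
  | base => simpa [seg] using PathOn.single (D := D) (q i)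
  | succ j hij ih =>
    have := (ih (by lia)).append (h.adj j (by lia) (by lia)) (PathOn.single _)
      (by
        rw [Finset.disjoint_singleton_right, h.mem_seg_iff hi (by lia) (by lia) (by lia)]
        lia)
    convert this using 1
    ext v
    simp only [mem_seg, Finset.mem_union, Finset.mem_singleton]
    constructor
    · rintro ⟨k, h1, h2, rfl⟩
      by_cases hk : k ≤ j
      · exact .inl ⟨k, h1, hk, rfl⟩
      · exact .inr (by rw [show k = j + 1 by lia])
    · rintro (⟨k, h1, h2, rfl⟩ | rfl)
      · exact ⟨k, h1, by lia, rfl⟩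
      · exact ⟨j + 1, by lia, by lia, rfl⟩

/-- A cycle of length `m`, unrolled into an `m`-periodic sequence of vertices. -/
structure IsCyc (D : Digraph V) (m : ℕ) (x : ℤ → V) : Prop where
  two_le : 2 ≤ m
  eq_iff : ∀ i j, x i = x j ↔ (m : ℤ) ∣ i - j
  adj : ∀ i, D.Adj (x i) (x (i + 1))

theorem IsCyc.isLine {m : ℕ} {x : ℤ → V} (h : D.IsCyc m x) {a b : ℤ} (hab : b < a + m) :
    D.IsLine x a b where
  inj i j h1 h2 h3 h4 he := by
    have := (h.eq_iff i j).1 he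
    have := Int.eq_zero_of_abs_lt_dvd this (by rw [abs_lt]; constructor <;> lia)
    lia
  adj i _ _ := h.adj i

theorem IsCyc.shift {m : ℕ} {x : ℤ → V} (h : D.IsCyc m x) (c : ℤ) :
    D.IsCyc m fun i => x (i + c) where
  two_le := h.two_le
  eq_iff i j := by rw [h.eq_iff]; simp
  adj i := by simpa [add_right_comm] using h.adj (i + c)

theorem IsCyc.add_period {m : ℕ} {x : ℤ → V} (h : D.IsCyc m x) (i : ℤ) : x (i + m) = x i := by
  rw [h.eq_iff]; simp

theorem IsCyc.ne {m : ℕ} {x : ℤ → V} (h : D.IsCyc m x) {i j : ℤ} (h1 : i < j) (h2 : j < i + m) :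
    x i ≠ x j := fun he => by
  have := (h.isLine h2).inj i j le_rfl h1.le h1.le le_rfl he
  lia

/-- Every vertex of the cycle has an index in any prescribed window of length `m`. -/
theorem IsCyc.exists_rep {m : ℕ} {x : ℤ → V} (h : D.IsCyc m x) (i a : ℤ) :
    ∃ j, a ≤ j ∧ j < a + m ∧ x j = x i ∧ (m : ℤ) ∣ j - i := by
  have hm : (0 : ℤ) < m := by have := h.two_le; lia
  have hd : (m : ℤ) ∣ (a + (i - a) % m) - i :=
    ⟨-((i - a) / m), by have := Int.emod_add_mul_ediv (i - a) m; lia⟩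
  refine ⟨a + (i - a) % m, ?_, ?_, (h.eq_iff _ _).2 hd, hd⟩
  · have := Int.emod_nonneg (i - a) hm.ne'; lia
  · have := Int.emod_lt_of_pos (i - a) hm; lia

theorem IsCyc.seg_eq_range {m : ℕ} {x : ℤ → V} (h : D.IsCyc m x) (a : ℤ) :
    (↑(seg x a (a + m - 1)) : Set V) = Set.range x := by
  ext v
  simp only [Finset.mem_coe, mem_seg, Set.mem_range]
  constructor
  · rintro ⟨k, _, _, rfl⟩; exact ⟨k, rfl⟩
  · rintro ⟨k, rfl⟩
    obtain ⟨j, h1, h2, h3, _⟩ := h.exists_rep k a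
    exact ⟨j, h1, by lia, h3⟩

theorem IsCyc.mem_seg_iff_range {m : ℕ} {x : ℤ → V} (h : D.IsCyc m x) (a : ℤ) {v : V} :
    v ∈ seg x a (a + m - 1) ↔ v ∈ Set.range x := by
  rw [← h.seg_eq_range a]; rfl

/-- Replacing the vertex at one position of the cycle by a vertex outside it. -/
theorem IsCyc.replace {m : ℕ} {x : ℤ → V} (h : D.IsCyc m x) {y : V} (hy : y ∉ Set.range x) {j : ℤ}
    (h1 : D.Adj (x (j - 1)) y) (h2 : D.Adj y (x (j + 1))) :
    D.IsCyc m fun i => if (m : ℤ) ∣ i - j then y else x i where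
  two_le := h.two_le
  eq_iff i k := by
    have key : ∀ i, x i ≠ y := fun i hi => hy ⟨i, hi⟩
    have hk : (m : ℤ) ∣ i - j → ((m : ℤ) ∣ k - j ↔ (m : ℤ) ∣ i - k) := fun hi => by
      rw [show i - k = (i - j) - (k - j) by ring, dvd_sub_right hi]
    have hk' : (m : ℤ) ∣ k - j → ((m : ℤ) ∣ i - j ↔ (m : ℤ) ∣ i - k) := fun hi => by
      rw [show i - k = (i - j) - (k - j) by ring, dvd_sub_left hi]
    by_cases hi : (m : ℤ) ∣ i - j <;> by_cases hk1 : (m : ℤ) ∣ k - j <;>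
      simp [hi, hk1, h.eq_iff, key, (key _).symm]
    · exact (hk hi).1 hk1
    · exact fun h' => hk1 ((hk hi).2 h')
    · exact fun h' => hi ((hk' hk1).2 h')
  adj i := by
    have hm := h.two_le
    by_cases hi : (m : ℤ) ∣ i - j
    · have hi' : ¬ (m : ℤ) ∣ i + 1 - j := fun h' => by
        have := (dvd_sub_right h').2 hi
        rw [show i + 1 - j - (i - j) = 1 by ring] at this
        have := Int.le_of_dvd one_pos this
        lia
      simp only [hi, hi', if_true, if_false]
      rwa [(h.eq_iff (i + 1) (j + 1)).2 (by simpa using hi)]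
    · by_cases hi' : (m : ℤ) ∣ i + 1 - j
      · simp only [hi, hi', if_true, if_false]
        rwa [(h.eq_iff i (j - 1)).2 (by convert hi' using 1; ring)]
      · simpa only [hi, hi', if_false] using h.adj i

/-- Every cycle can be unrolled. -/
theorem IsCycle.exists_isCyc {c : Cycle V} (hc : D.IsCycle c) :
    ∃ x, D.IsCyc c.length x ∧ ∀ v, v ∈ c ↔ v ∈ Set.range x := by
  induction c using Quotient.inductionOn' with | _ l
  obtain ⟨h1, h2, h3⟩ := hc
  change 2 ≤ l.length at h1
  change l.Nodup at h2
  change ∃ x, D.IsCyc l.length x ∧ ∀ v, v ∈ l ↔ v ∈ Set.range x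
  have hm : (0 : ℤ) < l.length := by lia
  have hlt : ∀ i : ℤ, (i % l.length).toNat < l.length := fun i => by
    have := Int.emod_lt_of_pos i hm
    have := Int.emod_nonneg i hm.ne'
    lia
  refine ⟨fun i => l[(i % l.length).toNat]'(hlt i), ⟨h1, ?_, ?_⟩, ?_⟩
  · intro i j
    rw [h2.getElem_inj_iff, ← Int.emod_emod_of_dvd i dvd_rfl]
    have := Int.emod_nonneg i hm.ne'
    have := Int.emod_nonneg j hm.ne'
    rw [← Int.emod_eq_emod_iff_emod_sub_eq_zero.trans (Int.dvd_iff_emod_eq_zero).symm,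
      Int.emod_emod_of_dvd i dvd_rfl]
    lia
  · intro i
    rcases l with - | ⟨a, l⟩
    · simp at h1
    change Cycle.Chain D.Adj ((a :: l : List V) : Cycle V) at h3
    rw [Cycle.chain_coe_cons, List.isChain_iff_getElem] at h3
    have h4 := h3 (i % (a :: l).length).toNat (by have := hlt i; simp at this ⊢; lia)
    have e1 := Int.emod_nonneg i hm.ne'
    have e2 := Int.emod_lt_of_pos i hm
    by_cases hlast : i % (a :: l).length + 1 = (a :: l).length
    · have e3 : (i + 1) % (a :: l).length = 0 := by
        rw [Int.add_emod, Int.emod_eq_of_lt (a := 1) (by lia) (by lia), hlast, Int.emod_self]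
      simp only [e3]
      have e4 : (i % (a :: l).length).toNat = l.length := by simp at hlast ⊢; lia
      simp only [e4] at h4 ⊢
      simp only [← List.cons_append] at h4
      rw [List.getElem_append_left (by simp), List.getElem_append_right (by simp)] at h4
      simpa using h4
    · have e3 : (i + 1) % (a :: l).length = i % (a :: l).length + 1 := by
        rw [Int.add_emod, Int.emod_eq_of_lt (a := 1) (by lia) (by lia),
          Int.emod_eq_of_lt (by lia) (by lia)]
      have e4 : ((i + 1) % (a :: l).length).toNat = (i % (a :: l).length).toNat + 1 := by
        rw [e3]; lia
      simp only [e4]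
      have e5 := hlt (i + 1)
      rw [e4] at e5
      simp only [← List.cons_append] at h4
      rw [List.getElem_append_left (by lia), List.getElem_append_left e5] at h4
      exact h4
  · intro v
    rw [List.mem_iff_getElem]
    constructor
    · rintro ⟨n, hn, rfl⟩
      refine ⟨n, ?_⟩
      have e : ((n : ℤ) % l.length).toNat = n := by
        rw [Int.emod_eq_of_lt (by lia) (by lia)]; rfl
      simp only [e]
    · rintro ⟨i, rfl⟩
      exact ⟨_, hlt i, rfl⟩

end Paths

end Digraph

/-! ### Counting arcs -/

namespace Digraph

section Counting

variable {V : Type*} [DecidableEq V] {D : Digraph V}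

open Classical in
/-- The number (`0` or `1`) of arcs from `u` to `v`. -/
noncomputable def arc (D : Digraph V) (u v : V) : ℕ := if D.Adj u v then 1 else 0

/-- The number of arcs between `u` and `v`, in both directions. -/
noncomputable def link (D : Digraph V) (u v : V) : ℕ := D.arc u v + D.arc v u

/-- The number of arcs between `u` and the vertices of `s`. -/
noncomputable def degOn (D : Digraph V) (u : V) (s : Finset V) : ℕ := ∑ v ∈ s, D.link u v

theorem arc_of_not_adj {u v : V} (h : ¬ D.Adj u v) : D.arc u v = 0 := if_neg h

theorem arc_le_one (u v : V) : D.arc u v ≤ 1 := by unfold arc; split <;> simp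

theorem arc_eq_one {u v : V} : D.arc u v = 1 ↔ D.Adj u v := by unfold arc; split <;> simp_all

theorem link_le_two (u v : V) : D.link u v ≤ 2 := by
  have := D.arc_le_one u v
  have := D.arc_le_one v u
  unfold link; lia

theorem link_self (hl : D.Loopless) (u : V) : D.link u u = 0 := by
  simp [link, arc_of_not_adj (hl u)]

theorem adj_of_link_eq_two {u v : V} (h : D.link u v = 2) : D.Adj u v ∧ D.Adj v u := by
  have := D.arc_le_one u v
  have := D.arc_le_one v u
  unfold link at h
  rw [← arc_eq_one, ← arc_eq_one (u := v)]; lia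

theorem degree_eq_degOn [Fintype V] (u : V) : D.degree u = D.degOn u Finset.univ := by
  classical
  unfold degree degOn link arc
  rw [Finset.sum_add_distrib, Finset.sum_boole, Finset.sum_boole, Set.ncard_eq_toFinset_card',
    Set.ncard_eq_toFinset_card']
  simp

theorem degOn_union {u : V} {s t : Finset V} (h : Disjoint s t) :
    D.degOn u (s ∪ t) = D.degOn u s + D.degOn u t := Finset.sum_union h

theorem degOn_insert {u v : V} {s : Finset V} (h : v ∉ s) :
    D.degOn u (insert v s) = D.link u v + D.degOn u s := Finset.sum_insert h

theorem degOn_le (u : V) (s : Finset V) : D.degOn u s ≤ 2 * s.card := by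
  have := Finset.sum_le_card_nsmul s (D.link u) 2 fun v _ => link_le_two u v
  rw [smul_eq_mul, mul_comm] at this
  exact this

theorem degOn_erase (hl : D.Loopless) (u : V) (s : Finset V) :
    D.degOn u (s.erase u) = D.degOn u s := by
  by_cases hu : u ∈ s
  · have := Finset.add_sum_erase s (D.link u) hu
    rw [link_self hl, zero_add] at this
    exact this
  · rw [Finset.erase_eq_of_notMem hu]

theorem degOn_add_two_le (hl : D.Loopless) {u : V} {s : Finset V} (hu : u ∈ s) :
    D.degOn u s + 2 ≤ 2 * s.card := by
  have := degOn_le (D := D) u (s.erase u)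
  rw [degOn_erase hl, Finset.card_erase_of_mem hu] at this
  have := Finset.card_pos.2 ⟨u, hu⟩
  lia

/-- A vertex with the maximal conceivable number of arcs to `s` is joined to all of `s` by arcs in
both directions. -/
theorem adj_of_two_mul_card_le {u : V} {s : Finset V} (h : 2 * s.card ≤ D.degOn u s) {v : V}
    (hv : v ∈ s) : D.Adj u v ∧ D.Adj v u := by
  refine adj_of_link_eq_two ?_
  have h1 := (Finset.sum_eq_sum_iff_of_le (s := s) (f := D.link u) (g := fun _ => 2)
    fun v _ => link_le_two u v).1
    (le_antisymm (Finset.sum_le_sum fun v _ => link_le_two u v)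
      (by rw [Finset.sum_const, smul_eq_mul, mul_comm]; exact h))
  exact h1 v hv

/-- A vertex that cannot be inserted into a path sends at most one more arc to it and from it than
the path has vertices. -/
theorem PathOn.degOn_le {u v w : V} {s : Finset V} (h : D.PathOn u v s) (hw : w ∉ s)
    (hno : ¬ D.PathOn u v (insert w s)) :
    D.degOn w s + 1 ≤ s.card + D.arc w u + D.arc v w := by
  induction h with
  | single u =>
    simp only [degOn, link, Finset.sum_singleton, Finset.card_singleton]
    lia
  | @cons u v z s huv hs hu ih =>
    have hwu : w ≠ u := fun h => hw (by simp [h])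
    have hws : w ∉ s := fun h => hw (by simp [h])
    have h1 := ih hws fun hp => hno (by
      rw [Finset.insert_comm]
      exact .cons huv hp (by simp [hwu.symm, hu]))
    have h2 : D.arc u w + D.arc w v ≤ 1 := by
      by_contra hcon
      have := D.arc_le_one u w
      have := D.arc_le_one w v
      refine hno ?_
      rw [Finset.insert_comm]
      exact .cons (arc_eq_one.1 (by lia)) (.cons (arc_eq_one.1 (by lia)) hs hws)
        (by simp [hwu.symm, hu])
    rw [degOn_insert hu, Finset.card_insert_of_notMem hu]
    unfold link
    lia

theorem IsLine.degOn_aux {q : ℤ → V} {a b : ℤ} (h : D.IsLine q a b) {w : V}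
    (hno : ∀ i, a ≤ i → i < b → ¬ (D.Adj (q i) w ∧ D.Adj w (q (i + 1)))) {c : ℤ} (hac : a ≤ c)
    (hcb : c ≤ b) :
    (D.degOn w (seg q a c) : ℤ) ≤ c - a + D.arc w (q a) + D.arc (q c) w ∧
      (c - a + D.arc w (q a) + D.arc (q c) w ≤ (D.degOn w (seg q a c) : ℤ) →
        ∀ i, a ≤ i → i < c → Xor (D.Adj (q i) w) (D.Adj w (q (i + 1)))) := by
  induction c, hac using Int.leInduction with
  | base =>
    have : seg q a a = {q a} := by simp [seg]
    rw [this]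
    simp only [degOn, Finset.sum_singleton, link]
    push_cast
    exact ⟨by lia, fun _ i h1 h2 => by lia⟩
  | succ c hac ih =>
    obtain ⟨ih1, ih2⟩ := ih (by lia)
    have hseg : seg q a (c + 1) = insert (q (c + 1)) (seg q a c) := by
      ext v
      simp only [mem_seg, Finset.mem_insert]
      constructor
      · rintro ⟨k, h1, h2, rfl⟩
        by_cases hk : k ≤ c
        · exact .inr ⟨k, h1, hk, rfl⟩
        · exact .inl (by rw [show k = c + 1 by lia])
      · rintro (rfl | ⟨k, h1, h2, rfl⟩)
        · exact ⟨c + 1, by lia, by lia, rfl⟩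
        · exact ⟨k, h1, by lia, rfl⟩
    have hnot : q (c + 1) ∉ seg q a c := by
      rw [h.mem_seg_iff le_rfl (by lia) (by lia) (by lia)]; lia
    rw [hseg, degOn_insert hnot]
    have h1 := D.arc_le_one (q c) w
    have h2 := D.arc_le_one w (q (c + 1))
    have hc := hno c hac (by lia)
    rw [← arc_eq_one, ← arc_eq_one (u := w)] at hc
    unfold link
    push_cast
    refine ⟨by lia, fun hle i hi hic => ?_⟩
    rcases eq_or_lt_of_le (show i ≤ c by lia) with rfl | hlt
    · unfold Xor
      rw [← arc_eq_one, ← arc_eq_one (u := w)]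
      lia
    · exact ih2 (by lia) i hi hlt

theorem IsLine.degOn_le {q : ℤ → V} {a b : ℤ} (h : D.IsLine q a b) (hab : a ≤ b) {w : V}
    (hno : ∀ i, a ≤ i → i < b → ¬ (D.Adj (q i) w ∧ D.Adj w (q (i + 1)))) :
    (D.degOn w (seg q a b) : ℤ) ≤ b - a + 2 := by
  have := (h.degOn_aux hno hab le_rfl).1
  have := D.arc_le_one (q b) w
  have := D.arc_le_one w (q a)
  lia

/-- The extremal case of `IsLine.degOn_le`. -/
theorem IsLine.of_le_degOn {q : ℤ → V} {a b : ℤ} (h : D.IsLine q a b) (hab : a ≤ b) {w : V}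
    (hno : ∀ i, a ≤ i → i < b → ¬ (D.Adj (q i) w ∧ D.Adj w (q (i + 1))))
    (hle : b - a + 2 ≤ (D.degOn w (seg q a b) : ℤ)) :
    D.Adj w (q a) ∧ D.Adj (q b) w ∧
      ∀ i, a ≤ i → i < b → Xor (D.Adj (q i) w) (D.Adj w (q (i + 1))) := by
  obtain ⟨h1, h2⟩ := h.degOn_aux hno hab le_rfl
  have := D.arc_le_one (q b) w
  have := D.arc_le_one w (q a)
  exact ⟨arc_eq_one.1 (by lia), arc_eq_one.1 (by lia), h2 (by lia)⟩

/-- If all degrees inside `T` exceed `|T| + N - 3`, where no path inside `T` has more than `N`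
vertices, then `T` is a clique of size `N`: the first vertex of a longest path has its in-neighbours
on the path, so its degree forces it to dominate `T` and to be dominated by the whole path; hence
the path closes up to a cycle and can be prolonged unless it exhausts `T`. -/
theorem isCompleteOn_of_paths_le (hl : D.Loopless) {T : Finset V} (hT : T.Nonempty) {N : ℕ}
    (hpath : ∀ u v s, s ⊆ T → D.PathOn u v s → s.card ≤ N)
    (hdeg : ∀ w ∈ T, T.card + N ≤ D.degOn w T + 2) : T.card = N ∧ D.IsCompleteOn T := by
  classical
  obtain ⟨y, hy⟩ := hT
  obtain ⟨s, hs, hsmax⟩ := Finset.exists_max_image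
    (T.powerset.filter fun s => ∃ u v, D.PathOn u v s) Finset.card
    ⟨{y}, by simpa [hy] using ⟨y, y, PathOn.single y⟩⟩
  simp only [Finset.mem_filter, Finset.mem_powerset] at hs hsmax
  obtain ⟨hsT, u, v, hp⟩ := hs
  have hmax : ∀ u' v' t, D.PathOn u' v' t → t ⊆ T → t.card ≤ s.card :=
    fun u' v' t hp ht => hsmax t ⟨ht, u', v', hp⟩
  have huT := hsT hp.left_mem
  have hcard := hpath u v s hsT hp
  have hin : ∀ z ∈ T, z ∉ s → ¬ D.Adj z u := fun z hz hzs hzu => by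
    have := hmax _ _ _ (.cons hzu hp hzs) (Finset.insert_subset hz hsT)
    rw [Finset.card_insert_of_notMem hzs] at this
    lia
  -- the arcs leaving and entering `u`, counted separately
  have hsplit : D.degOn u T = ∑ z ∈ T, D.arc u z + ∑ z ∈ T, D.arc z u := by
    unfold degOn link; rw [Finset.sum_add_distrib]
  have hout : ∑ z ∈ T, D.arc u z = ∑ z ∈ T.erase u, D.arc u z := by
    rw [← Finset.add_sum_erase T _ huT, arc_of_not_adj (hl u), zero_add]
  have hout_le : ∑ z ∈ T.erase u, D.arc u z ≤ ∑ z ∈ T.erase u, 1 :=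
    Finset.sum_le_sum fun z _ => D.arc_le_one u z
  have hin_eq : ∑ z ∈ T, D.arc z u = ∑ z ∈ s.erase u, D.arc z u := by
    rw [← Finset.sum_subset hsT fun z hz hzs => arc_of_not_adj (hin z hz hzs),
      ← Finset.add_sum_erase s _ hp.left_mem, arc_of_not_adj (hl u), zero_add]
  have hin_le : ∑ z ∈ s.erase u, D.arc z u ≤ ∑ z ∈ s.erase u, 1 :=
    Finset.sum_le_sum fun z _ => D.arc_le_one z u
  have hd := hdeg u huT
  have c1 : ∑ z ∈ T.erase u, 1 = T.card - 1 := by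
    rw [Finset.sum_const, smul_eq_mul, mul_one, Finset.card_erase_of_mem huT]
  have c2 : ∑ z ∈ s.erase u, 1 = s.card - 1 := by
    rw [Finset.sum_const, smul_eq_mul, mul_one, Finset.card_erase_of_mem hp.left_mem]
  have hTpos : 0 < T.card := Finset.card_pos.2 ⟨u, huT⟩
  have hspos : 0 < s.card := Finset.card_pos.2 ⟨u, hp.left_mem⟩
  have hout_adj : ∀ z ∈ T, z ≠ u → D.Adj u z := fun z hz hzu =>
    arc_eq_one.1 ((Finset.sum_eq_sum_iff_of_le fun z _ => D.arc_le_one u z).1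
      (le_antisymm hout_le (by lia)) z (Finset.mem_erase.2 ⟨hzu, hz⟩))
  have hin_adj : ∀ z ∈ s, z ≠ u → D.Adj z u := fun z hz hzu =>
    arc_eq_one.1 ((Finset.sum_eq_sum_iff_of_le fun z _ => D.arc_le_one z u).1
      (le_antisymm hin_le (by lia)) z (Finset.mem_erase.2 ⟨hzu, hz⟩))
  have hsT' : s = T := by
    refine hsT.antisymm fun w hw => ?_
    by_contra hws
    have hwu : w ≠ u := fun h => hws (h ▸ hp.left_mem)
    have huw := hout_adj w hw hwu
    suffices h : ∃ u', D.PathOn u' w (insert w s) by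
      obtain ⟨u', hp'⟩ := h
      have := hmax _ _ _ hp' (Finset.insert_subset hw hsT)
      rw [Finset.card_insert_of_notMem hws] at this
      lia
    cases hp with
    | single =>
      exact ⟨u, by
        rw [Finset.pair_comm]
        exact .cons huw (.single w) (by simpa using hwu.symm)⟩
    | @cons _ u' _ t huu' ht hut =>
      refine ⟨u', ?_⟩
      have hwt : w ∉ t := fun h => hws (by simp [h])
      have h1 := ht.append (hin_adj v (by simp [ht.right_mem]) fun h => hut (h ▸ ht.right_mem))
        (PathOn.cons huw (.single w) (by simpa using hwu.symm))
        (by simp [hut, hwt])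
      convert h1 using 1
      ext; simp; tauto
  have hTN : T.card = N := by
    rw [hsT'] at hcard
    have := degOn_add_two_le hl huT
    lia
  refine ⟨hTN, fun a ha b hb hab => ?_⟩
  refine (adj_of_two_mul_card_le (s := T.erase a) ?_ (Finset.mem_erase.2 ⟨hab.symm, hb⟩)).1
  rw [degOn_erase hl, Finset.card_erase_of_mem ha]
  have := hdeg a ha
  lia

end Counting

end Digraph

/-! ### The structure around a shortest bypass of a longest cycle -/

namespace Digraph

section Structure

variable {V : Type*} [DecidableEq V] {D : Digraph V}

/-- From the vertex `x i` one can walk to `y`, leaving the range of `x` at once and for good. -/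
def Enters (D : Digraph V) (x : ℤ → V) (y : V) (i : ℤ) : Prop :=
  ∃ u, u ∉ Set.range x ∧ D.Adj (x i) u ∧ D.WalkIn (Set.range x)ᶜ u y

/-- From `y` one can walk to the vertex `x i`, meeting the range of `x` only there. -/
def Exits (D : Digraph V) (x : ℤ → V) (y : V) (i : ℤ) : Prop :=
  ∃ v, v ∉ Set.range x ∧ D.WalkIn (Set.range x)ᶜ y v ∧ D.Adj v (x i)

/-- Two blocks `A` and `B` attached in the same way to a path `q a, …, q b`: both are cliques of the
same size, there are no arcs between them, both precede `q a` and succeed `q b`, neither can be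
inserted between two consecutive vertices of the path, each vertex outside is joined to all of
`A ∪ B` by arcs of a single direction, and no walk outside leads from `A ∪ B` back to it. Moreover
no cycle of `D` is longer than `m`, the length of a cycle consisting of the path and one block. -/
structure TwinBlocks (D : Digraph V) (m : ℕ) (q : ℤ → V) (a b : ℤ) (A B : Finset V) : Prop where
  lt : a < b
  line : D.IsLine q a b
  max : ∀ k, D.HasCycleOfLength k → k ≤ m
  pos : A.Nonempty
  card_eq : B.card = A.card
  length : (m : ℤ) = b + 1 - a + A.card
  disj : Disjoint A B
  disjA : Disjoint A (seg q a b)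
  disjB : Disjoint B (seg q a b)
  completeA : D.IsCompleteOn A
  completeB : D.IsCompleteOn B
  not_adj : ∀ u ∈ A, ∀ v ∈ B, ¬ D.Adj u v ∧ ¬ D.Adj v u
  to_first : ∀ h ∈ A ∪ B, D.Adj h (q a)
  from_last : ∀ h ∈ A ∪ B, D.Adj (q b) h
  xor : ∀ h ∈ A ∪ B, ∀ j, a ≤ j → j < b → Xor (D.Adj (q j) h) (D.Adj h (q (j + 1)))
  outside : ∀ z, z ∉ A ∪ B ∪ seg q a b →
    (∀ h ∈ A ∪ B, D.Adj h z ∧ ¬ D.Adj z h) ∨ (∀ h ∈ A ∪ B, D.Adj z h ∧ ¬ D.Adj h z)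
  no_return : ∀ z w, z ∉ A ∪ B ∪ seg q a b → D.WalkIn (↑(A ∪ B ∪ seg q a b) : Set V)ᶜ z w →
    ∀ h ∈ A ∪ B, ∀ h' ∈ A ∪ B, D.Adj h z → ¬ D.Adj w h'

theorem TwinBlocks.symm {m : ℕ} {q : ℤ → V} {a b : ℤ} {A B : Finset V}
    (h : D.TwinBlocks m q a b A B) : D.TwinBlocks m q a b B A where
  lt := h.lt
  line := h.line
  max := h.max
  pos := by rw [← Finset.card_pos, h.card_eq, Finset.card_pos]; exact h.pos
  card_eq := h.card_eq.symm
  length := by rw [h.card_eq]; exact h.length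
  disj := h.disj.symm
  disjA := h.disjB
  disjB := h.disjA
  completeA := h.completeB
  completeB := h.completeA
  not_adj u hu v hv := (h.not_adj v hv u hu).symm
  to_first := by rw [Finset.union_comm]; exact h.to_first
  from_last := by rw [Finset.union_comm]; exact h.from_last
  xor := by rw [Finset.union_comm]; exact h.xor
  outside := by rw [Finset.union_comm B]; exact h.outside
  no_return := by rw [Finset.union_comm B]; exact h.no_return

variable [Fintype V]

/-- If no walk of length two through `R` joins the non-adjacent vertices `w ∈ R` and `v`, then each
vertex of `R` other than `w` carries at most two of the arcs counted by the degrees of `w` and `v`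
in `R`; the second part is the case of equality. -/
theorem degOn_add_degOn_le (hl : D.Loopless) {R : Finset V} {w v : V} (hw : w ∈ R)
    (hwv : ¬ D.Adj w v ∧ ¬ D.Adj v w)
    (h1 : ∀ z ∈ R, z ≠ w → ¬ (D.Adj w z ∧ D.Adj z v))
    (h2 : ∀ z ∈ R, z ≠ w → ¬ (D.Adj v z ∧ D.Adj z w)) :
    D.degOn w R + D.degOn v R + 2 ≤ 2 * R.card ∧
      (2 * R.card ≤ D.degOn w R + D.degOn v R + 2 → ∀ z ∈ R, z ≠ w →
        Xor (D.Adj w z) (D.Adj z v) ∧ Xor (D.Adj v z) (D.Adj z w)) := by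
  have e1 : D.degOn v R = D.degOn v (R.erase w) := by
    unfold degOn
    rw [← Finset.add_sum_erase R _ hw]
    simp [link, arc_of_not_adj hwv.1, arc_of_not_adj hwv.2]
  have e2 : D.degOn w R = D.degOn w (R.erase w) := (degOn_erase hl _ _).symm
  have e3 : D.degOn w R + D.degOn v R = ∑ z ∈ R.erase w, (D.link w z + D.link v z) := by
    rw [e1, e2, degOn, degOn, ← Finset.sum_add_distrib]
  have hle : ∀ z ∈ R.erase w, D.link w z + D.link v z ≤ 2 := fun z hz => by
    obtain ⟨hzw, hz⟩ := Finset.mem_erase.1 hz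
    have h1 := h1 z hz hzw
    have h2 := h2 z hz hzw
    rw [← arc_eq_one, ← arc_eq_one (u := z)] at h1 h2
    have := D.arc_le_one w z
    have := D.arc_le_one z w
    have := D.arc_le_one v z
    have := D.arc_le_one z v
    unfold link
    lia
  have hc : ∑ z ∈ R.erase w, 2 = 2 * R.card - 2 := by
    rw [Finset.sum_const, smul_eq_mul, Finset.card_erase_of_mem hw]; lia
  have hpos := Finset.card_pos.2 ⟨w, hw⟩
  have hsum := Finset.sum_le_sum hle
  refine ⟨by lia, fun hge z hz hzw => ?_⟩
  have := (Finset.sum_eq_sum_iff_of_le hle).1 (le_antisymm hsum (by lia)) z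
    (Finset.mem_erase.2 ⟨hzw, hz⟩)
  have h1 := h1 z hz hzw
  have h2 := h2 z hz hzw
  rw [← arc_eq_one, ← arc_eq_one (u := z)] at h1 h2
  have := D.arc_le_one w z
  have := D.arc_le_one z w
  have := D.arc_le_one v z
  have := D.arc_le_one z v
  unfold link at *
  unfold Xor
  simp only [← arc_eq_one]
  lia

/-- Multiple insertion: let `w` lie outside `C` and have at most `|Q| + 1` arcs to and from `C`. If
`C` is not the vertex set of a path from `a` to `b`, then no path from `a` to `b` with `Q ⊆ L ⊆ C`
has more vertices than `Q`. Otherwise a vertex of `C` that cannot be inserted into a longest such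
path would, together with `w`, violate the degree condition. -/
theorem card_le_of_pathOn (hdeg : ∀ v, Fintype.card V ≤ D.degOn v Finset.univ + 1)
    {R C Q L : Finset V} {w a b : V} (hR : R = Cᶜ) (hfull : ¬ D.PathOn a b C)
    (hwC : D.degOn w C ≤ Q.card + 1) (hl : D.Loopless)
    (hcross : ∀ v ∈ C, v ∉ Q → D.degOn w R + D.degOn v R + 2 ≤ 2 * R.card)
    (hL : D.PathOn a b L) (hQL : Q ⊆ L) (hLC : L ⊆ C) : L.card ≤ Q.card := by
  classical
  obtain ⟨M, hM, hMmax⟩ := Finset.exists_max_image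
    (C.powerset.filter fun s => D.PathOn a b s ∧ Q ⊆ s) Finset.card
    ⟨L, by simp [hL, hQL, hLC]⟩
  simp only [Finset.mem_filter, Finset.mem_powerset] at hM hMmax
  obtain ⟨hMC, hMp, hQM⟩ := hM
  refine (hMmax L ⟨hLC, hL, hQL⟩).trans ?_
  obtain ⟨v, hvC, hvM⟩ : ∃ v ∈ C, v ∉ M := by
    by_contra! hcon
    exact hfull (hMC.antisymm hcon ▸ hMp)
  have h1 := hMp.degOn_le hvM fun hp => by
    have := hMmax _ ⟨Finset.insert_subset hvC hMC, hp, hQM.trans (Finset.subset_insert _ _)⟩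
    rw [Finset.card_insert_of_notMem hvM] at this
    lia
  have h2 := degOn_add_two_le hl (Finset.mem_sdiff.2 ⟨hvC, hvM⟩)
  have h3 := hcross v hvC fun h => hvM (hQM h)
  have h4 : D.degOn v C = D.degOn v M + D.degOn v (C \ M) := by
    rw [← degOn_union Finset.disjoint_sdiff, Finset.union_sdiff_of_subset hMC]
  have h5 : ∀ u, D.degOn u Finset.univ = D.degOn u C + D.degOn u R := fun u => by
    rw [hR, ← degOn_union disjoint_compl_right, Finset.union_compl]
  have h6 := hdeg w
  have h7 := hdeg v
  rw [h5] at h6 h7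
  have h8 : Fintype.card V = C.card + R.card := by rw [hR, Finset.card_add_card_compl]
  have h9 : (C \ M).card + M.card = C.card := Finset.card_sdiff_add_card_eq_card hMC
  have h10 := D.arc_le_one v a
  have h11 := D.arc_le_one b v
  lia

set_option maxHeartbeats 1000000 in
/-- Let `x` be a longest cycle and `y` a vertex outside it. Suppose that one can walk from `x i`
through `y` to `x (i + g)`, outside the cycle in between, and that `g` is minimal. Then the strong
component of `y` outside the cycle and the part of the cycle skipped by the walk are twin blocks
attached to the rest of the cycle: all the inequalities between degrees that lead to a
contradiction under Meyniel's condition become equalities. -/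
theorem exists_twinBlocks (hl : D.Loopless)
    (hdeg : ∀ v, Fintype.card V ≤ D.degOn v Finset.univ + 1) {m : ℕ} {x : ℤ → V}
    (hc : D.IsCyc m x) (hmax : ∀ k, D.HasCycleOfLength k → k ≤ m) {y : V}
    (hy : y ∉ Set.range x) {i g : ℤ} (hg : 0 < g) (hgm : g < m) (hin : D.Enters x y i)
    (hout : D.Exits x y (i + g))
    (hmin : ∀ j g', 0 < g' → g' < g → D.Enters x y j → ¬ D.Exits x y (j + g')) :
    ∃ T : Finset V, y ∈ T ∧ (T.card : ℤ) = g - 1 ∧ (∀ z ∈ T, z ∉ Set.range x) ∧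
      (∀ z, z ∉ Set.range x → D.WalkIn (Set.range x)ᶜ y z → D.WalkIn (Set.range x)ᶜ z y → z ∈ T) ∧
      D.TwinBlocks m x (i + g) (i + m) T (seg x (i + 1) (i + g - 1)) := by
  classical
  have hm := hc.two_le
  set C := seg x (i + 1) (i + m) with hC
  set Q := seg x (i + g) (i + m) with hQ
  set I := seg x (i + 1) (i + g - 1) with hI
  set R := Cᶜ with hR
  have hlC : D.IsLine x (i + 1) (i + m) := hc.isLine (by lia)
  have memC : ∀ v, v ∈ C ↔ v ∈ Set.range x := fun v => by
    rw [← hc.mem_seg_iff_range (i + 1), hC, show i + 1 + (m : ℤ) - 1 = i + m by ring]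
  have memR : ∀ v, v ∈ R ↔ v ∉ Set.range x := fun v => by rw [hR, Finset.mem_compl, memC]
  have hlQ : D.IsLine x (i + g) (i + m) := hc.isLine (by lia)
  have hQC : Q ⊆ C := seg_subset x (by lia) le_rfl
  have hIC : I ⊆ C := seg_subset x le_rfl (by lia)
  have hIQ : Disjoint I Q := hlC.seg_disjoint le_rfl le_rfl (by lia)
  have hCIQ : I ∪ Q = C := by
    ext v
    rw [Finset.mem_union, hI, hQ, hC, mem_seg, mem_seg, mem_seg]
    constructor
    · rintro (⟨k, h1, h2, h3⟩ | ⟨k, h1, h2, h3⟩) <;> exact ⟨k, by lia, by lia, h3⟩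
    · rintro ⟨k, h1, h2, h3⟩
      by_cases hk : k ≤ i + g - 1
      · exact .inl ⟨k, by lia, by lia, h3⟩
      · exact .inr ⟨k, by lia, by lia, h3⟩
  have cC : C.card = m := by rw [hC, hlC.card_seg le_rfl le_rfl]; lia
  have cQ : (Q.card : ℤ) = m - g + 1 := by rw [hQ, hlQ.card_seg le_rfl le_rfl]; lia
  have cI : (I.card : ℤ) = g - 1 := by rw [hI, hlC.card_seg le_rfl (by lia)]; lia
  have cV : Fintype.card V = m + R.card := by rw [← cC, hR, Finset.card_add_card_compl]
  have hdegC : ∀ u, D.degOn u Finset.univ = D.degOn u C + D.degOn u R := fun u => by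
    rw [hR, ← degOn_union disjoint_compl_right, Finset.union_compl]
  have hdegIQ : ∀ u, D.degOn u C = D.degOn u I + D.degOn u Q := fun u => by
    rw [← hCIQ, degOn_union hIQ]
  have hlast : x (i + m) = x i := hc.add_period i
  -- walks outside the cycle
  have hyR : y ∈ (Set.range x)ᶜ := hy
  let T : Finset V := R.filter fun z =>
    D.WalkIn (Set.range x)ᶜ y z ∧ D.WalkIn (Set.range x)ᶜ z y
  have memT : ∀ z, z ∈ T ↔ z ∉ Set.range x ∧ D.WalkIn (Set.range x)ᶜ y z ∧
      D.WalkIn (Set.range x)ᶜ z y := fun z => by rw [Finset.mem_filter, memR]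
  have hyT : y ∈ T := (memT y).2 ⟨hy, .refl, .refl⟩
  have hTR : T ⊆ R := Finset.filter_subset _ _
  have skip : ∀ j, i + 1 ≤ j → j ≤ i + g - 1 → ¬ D.Enters x y j ∧ ¬ D.Exits x y j :=
    fun j h1 h2 => by
    constructor
    · intro h
      refine hmin j (i + g - j) (by lia) (by lia) h ?_
      rwa [add_sub_cancel]
    · intro h
      refine hmin i (j - i) (by lia) (by lia) hin ?_
      rwa [add_sub_cancel]
  have enters_of : ∀ j z w, w ∈ T → z ∉ Set.range x → D.Adj (x j) z →
      D.WalkIn (Set.range x)ᶜ z w → D.Enters x y j :=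
    fun j z w hw hz hj hzw => ⟨z, hz, hj, hzw.trans ((memT w).1 hw).2.2⟩
  have exits_of : ∀ j z w, w ∈ T → z ∉ Set.range x → D.Adj z (x j) →
      D.WalkIn (Set.range x)ᶜ w z → D.Exits x y j :=
    fun j z w hw hz hj hzw => ⟨z, hz, ((memT w).1 hw).2.1.trans hzw, hj⟩
  have hTI : ∀ w ∈ T, ∀ v ∈ I, ¬ D.Adj w v ∧ ¬ D.Adj v w := by
    intro w hw v hv
    obtain ⟨j, h1, h2, rfl⟩ := mem_seg.1 hv
    have hwR := ((memT w).1 hw).1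
    exact ⟨fun h => (skip j h1 h2).2 (exits_of j w w hw hwR h .refl),
      fun h => (skip j h1 h2).1 (enters_of j w w hw hwR h .refl)⟩
  have hcross : ∀ w ∈ T, ∀ v ∈ I, _ := fun w hw v hv =>
    degOn_add_degOn_le (w := w) (v := v) hl (hTR hw) (hTI w hw v hv)
      (by
        obtain ⟨j, h1, h2, rfl⟩ := mem_seg.1 hv
        rintro z hz - ⟨h3, h4⟩
        have hzR := (memR z).1 hz
        exact (skip j h1 h2).2 (exits_of j z w hw hzR h4 (.arc ((memT w).1 hw).1 hzR h3)))
      (by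
        obtain ⟨j, h1, h2, rfl⟩ := mem_seg.1 hv
        rintro z hz - ⟨h3, h4⟩
        have hzR := (memR z).1 hz
        exact (skip j h1 h2).1 (enters_of j z w hw hzR h3 (.arc hzR ((memT w).1 hw).1 h4)))
  -- no vertex outside can be inserted into the cycle
  have noins : ∀ w ∈ T, ∀ j, i + g ≤ j → j < i + m →
      ¬ (D.Adj (x j) w ∧ D.Adj w (x (j + 1))) := by
    rintro w hw j - - ⟨h1, h2⟩
    have hl' : D.IsLine x (j + 1) (j + m) := hc.isLine (by lia)
    have hp := hl'.pathOn le_rfl (by lia) le_rfl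
    rw [hc.add_period] at hp
    have hws : w ∉ seg x (j + 1) (j + m) := fun h => by
      obtain ⟨k, _, _, rfl⟩ := mem_seg.1 h
      exact ((memT _).1 hw).1 ⟨k, rfl⟩
    have h3 := (PathOn.cons h2 hp hws).hasCycle h1
    rw [Finset.card_insert_of_notMem hws, hl'.card_seg le_rfl le_rfl] at h3
    have := hmax _ (h3 (by lia))
    lia
  have hwQ : ∀ w ∈ T, (D.degOn w Q : ℤ) ≤ m - g + 2 := fun w hw => by
    have := hlQ.degOn_le (by lia) (noins w hw)
    lia
  have hwI : ∀ w ∈ T, D.degOn w I = 0 := fun w hw =>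
    Finset.sum_eq_zero fun v hv => by
      simp [link, arc_of_not_adj (hTI w hw v hv).1, arc_of_not_adj (hTI w hw v hv).2]
  -- joining the ends of a path over the cycle through a path outside it
  have close : ∀ L : Finset V, L ⊆ C → D.PathOn (x (i + g)) (x (i + m)) L → ∀ u v s, s ⊆ R →
      D.PathOn u v s → D.Adj (x i) u → D.Adj v (x (i + g)) → L.card + s.card ≤ m := by
    intro L hLC hL u v s hs hp hu hv
    have hd : Disjoint L s := Finset.disjoint_of_subset_left hLC
      (Finset.disjoint_of_subset_right hs disjoint_compl_right)
    have := (hL.append (hlast ▸ hu) hp hd).hasCycle hv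
      (by
        rw [Finset.card_union_of_disjoint hd]
        have := Finset.card_pos.2 ⟨_, hL.left_mem⟩
        have := Finset.card_pos.2 ⟨_, hp.left_mem⟩
        lia)
    rw [Finset.card_union_of_disjoint hd] at this
    exact hmax _ this
  have hfull : ¬ D.PathOn (x (i + g)) (x (i + m)) C := by
    intro hp
    obtain ⟨u, hu, hiu, huy⟩ := hin
    obtain ⟨v, hv, hyv, hvi⟩ := hout
    obtain ⟨s, hs, hps⟩ := (huy.trans hyv).exists_pathOn hv
    have := close C subset_rfl hp u v s (fun z hz => (memR z).2 (hs hz)) hps hiu hvi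
    have := Finset.card_pos.2 ⟨_, hps.left_mem⟩
    lia
  have hQp : D.PathOn (x (i + g)) (x (i + m)) Q := hlQ.pathOn le_rfl (by lia) le_rfl
  have hIne : I.Nonempty := by
    rw [Finset.nonempty_iff_ne_empty]
    intro hI0
    rw [hI0, Finset.empty_union] at hCIQ
    exact hfull (hCIQ ▸ hQp)
  have hIpos := Finset.card_pos.2 hIne
  have hmaxL : ∀ L, D.PathOn (x (i + g)) (x (i + m)) L → Q ⊆ L → L ⊆ C → L.card ≤ Q.card :=
    fun L => card_le_of_pathOn (w := y) hdeg hR hfull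
      (by have := hwQ y hyT; have := hwI y hyT; rw [hdegIQ]; lia) hl
      fun v hv hvQ => (hcross y hyT v (by
        rw [← hCIQ, Finset.mem_union] at hv; exact hv.resolve_right hvQ)).1
  have noinsI : ∀ v ∈ I, ∀ j, i + g ≤ j → j < i + m →
      ¬ (D.Adj (x j) v ∧ D.Adj v (x (j + 1))) := by
    rintro v hv j h1 h2 ⟨h3, h4⟩
    have hvQ : v ∉ Q := Finset.disjoint_left.1 hIQ hv
    have hp1 := hlQ.pathOn le_rfl h1 h2.le
    have hp2 := hlQ.pathOn (i := j + 1) (by lia) (by lia) le_rfl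
    have hu : seg x (i + g) j ∪ seg x (j + 1) (i + m) = Q := by
      ext v
      rw [Finset.mem_union, hQ, mem_seg, mem_seg, mem_seg]
      constructor
      · rintro (⟨k, h1, h2, h3⟩ | ⟨k, h1, h2, h3⟩) <;> exact ⟨k, by lia, by lia, h3⟩
      · rintro ⟨k, h1, h2, h3⟩
        by_cases hk : k ≤ j
        · exact .inl ⟨k, by lia, by lia, h3⟩
        · exact .inr ⟨k, by lia, by lia, h3⟩
    have hv2 : v ∉ seg x (j + 1) (i + m) := fun h => hvQ (hu ▸ Finset.mem_union_right _ h)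
    have hv1 : v ∉ seg x (i + g) j := fun h => hvQ (hu ▸ Finset.mem_union_left _ h)
    have hp := hp1.append h3 (.cons h4 hp2 hv2) (by
      rw [Finset.disjoint_insert_right]
      exact ⟨hv1, hlQ.seg_disjoint le_rfl le_rfl (by lia)⟩)
    rw [Finset.union_insert, hu] at hp
    have := hmaxL _ hp (Finset.subset_insert _ _) (Finset.insert_subset (hIC hv) hQC)
    rw [Finset.card_insert_of_notMem hvQ] at this
    lia
  have hvQ : ∀ v ∈ I, (D.degOn v Q : ℤ) ≤ m - g + 2 := fun v hv => by
    have := hlQ.degOn_le (by lia) (noinsI v hv)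
    lia
  -- all the estimates are sharp
  have sharp : ∀ w ∈ T, ∀ v ∈ I, (D.degOn w Q : ℤ) = m - g + 2 ∧ (D.degOn v Q : ℤ) = m - g + 2 ∧
      D.degOn w R + D.degOn v R + 2 = 2 * R.card ∧ (D.degOn v I : ℤ) = 2 * (g - 1) - 2 ∧
      (D.degOn w R : ℤ) = R.card + g - 3 := by
    intro w hw v hv
    have h1 := hwQ w hw
    have h2 := hvQ v hv
    have h3 := (hcross w hw v hv).1
    have h4 := degOn_add_two_le hl hv
    have h5 := hdeg w
    have h6 := hdeg v
    rw [hdegC, hdegIQ, hwI w hw] at h5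
    rw [hdegC, hdegIQ] at h6
    lia
  obtain ⟨v₀, hv₀⟩ := hIne
  have hattT : ∀ w ∈ T, _ := fun w hw =>
    hlQ.of_le_degOn (by lia) (noins w hw) (by have := (sharp w hw v₀ hv₀).1; lia)
  have hattI : ∀ v ∈ I, _ := fun v hv =>
    hlQ.of_le_degOn (by lia) (noinsI v hv) (by have := (sharp y hyT v hv).2.1; lia)
  have hxor : ∀ w ∈ T, ∀ v ∈ I, ∀ z ∈ R, z ≠ w → _ := fun w hw v hv =>
    (hcross w hw v hv).2 (sharp w hw v hv).2.2.1.ge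
  -- arcs between the component and the rest of the outside go one way
  have honeway : ∀ w ∈ T, ∀ z ∈ R, z ∉ T → ∀ w' ∈ T, ¬ (D.Adj w z ∧ D.Adj z w') := by
    rintro w hw z hz hzT w' hw' ⟨h1, h2⟩
    have hzR := (memR z).1 hz
    have hw := (memT w).1 hw
    have hw' := (memT w').1 hw'
    exact hzT ((memT z).2 ⟨hzR, hw.2.1.trans (.arc hw.1 hzR h1),
      WalkIn.trans (.arc hzR hw'.1 h2) hw'.2.2⟩)
  have hlink : ∀ w ∈ T, ∀ z ∈ R \ T, D.link w z ≤ 1 := fun w hw z hz => by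
    rw [Finset.mem_sdiff] at hz
    have h := honeway w hw z hz.1 hz.2 w hw
    rw [← arc_eq_one, ← arc_eq_one (u := z)] at h
    have := D.arc_le_one w z
    have := D.arc_le_one z w
    unfold link; lia
  have cRT : (R \ T).card + T.card = R.card := Finset.card_sdiff_add_card_eq_card hTR
  have hdegRT : ∀ w, D.degOn w R = D.degOn w (R \ T) + D.degOn w T := fun w => by
    rw [← degOn_union Finset.sdiff_disjoint, Finset.sdiff_union_of_subset hTR]
  have hdegR : ∀ w ∈ T, D.degOn w (R \ T) ≤ (R \ T).card := fun w hw => by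
    have := Finset.sum_le_card_nsmul _ _ 1 (hlink w hw)
    simpa [degOn] using this
  obtain ⟨cT, hTcomp⟩ := isCompleteOn_of_paths_le hl ⟨y, hyT⟩ (N := (g - 1).toNat)
    (fun u v s hs hp => by
      have := close Q hQC hQp u v s (hs.trans hTR) hp (hlast ▸ (hattT u (hs hp.left_mem)).2.1)
        (hattT v (hs hp.right_mem)).1
      lia)
    (fun w hw => by
      have := (sharp w hw v₀ hv₀).2.2.2.2
      have := hdegR w hw
      have := hdegRT w
      lia)
  have hIcomp : D.IsCompleteOn I := fun a ha b hb hab => by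
    refine (adj_of_two_mul_card_le (s := I.erase a) ?_ (Finset.mem_erase.2 ⟨hab.symm, hb⟩)).1
    rw [degOn_erase hl, Finset.card_erase_of_mem ha]
    have := (sharp y hyT a ha).2.2.2.1
    lia
  have hone : ∀ w ∈ T, ∀ z ∈ R \ T, D.link w z = 1 := fun w hw => by
    refine (Finset.sum_eq_sum_iff_of_le (hlink w hw)).1
      (le_antisymm (Finset.sum_le_sum (hlink w hw)) ?_)
    have h1 := (sharp w hw v₀ hv₀).2.2.2.2
    have h2 := hdegR w hw
    have h3 := hdegRT w
    have h4 := degOn_add_two_le hl hw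
    rw [Finset.sum_const, smul_eq_mul, mul_one]
    change _ ≤ D.degOn w (R \ T)
    lia
  have memU : ∀ z, z ∉ T ∪ I ∪ Q ↔ z ∈ R \ T := fun z => by
    rw [Finset.union_assoc, hCIQ, Finset.mem_union, Finset.mem_sdiff, hR, Finset.mem_compl]
    tauto
  have houtside : ∀ z ∈ R \ T, (∀ h ∈ T ∪ I, D.Adj h z ∧ ¬ D.Adj z h) ∨
      (∀ h ∈ T ∪ I, D.Adj z h ∧ ¬ D.Adj h z) := by
    intro z hz
    obtain ⟨hzR, hzT⟩ := Finset.mem_sdiff.1 hz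
    have hne : ∀ w ∈ T, z ≠ w := fun w hw h => hzT (h ▸ hw)
    have hw : ∀ w ∈ T, (D.Adj w z ∧ ¬ D.Adj z w) ∨ (D.Adj z w ∧ ¬ D.Adj w z) := fun w hw => by
      have := hone w hw z hz
      have := D.arc_le_one w z
      have := D.arc_le_one z w
      unfold link at *
      simp only [← arc_eq_one]
      lia
    rcases hw y hyT with hyz | hzy
    · left
      have hT : ∀ w ∈ T, D.Adj w z ∧ ¬ D.Adj z w := fun w hw' =>
        (hw w hw').resolve_right fun h => honeway y hyT z hzR hzT w hw' ⟨hyz.1, h.1⟩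
      intro h hh
      rcases Finset.mem_union.1 hh with hh | hh
      · exact hT h hh
      · have := hxor y hyT h hh z hzR (hne y hyT)
        unfold Xor at this
        tauto
    · right
      have hT : ∀ w ∈ T, D.Adj z w ∧ ¬ D.Adj w z := fun w hw' =>
        (hw w hw').resolve_left fun h => honeway w hw' z hzR hzT y hyT ⟨h.1, hzy.1⟩
      intro h hh
      rcases Finset.mem_union.1 hh with hh | hh
      · exact hT h hh
      · have := hxor y hyT h hh z hzR (hne y hyT)
        unfold Xor at this
        tauto
  refine ⟨T, hyT, by lia, fun z hz => ((memT z).1 hz).1, fun z h1 h2 h3 => (memT z).2 ⟨h1, h2, h3⟩,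
    ?_⟩
  refine ⟨by lia, hlQ, hmax, ⟨y, hyT⟩, by lia, by lia, ?_, ?_, hIQ, hTcomp, hIcomp, hTI, ?_, ?_, ?_,
    ?_, ?_⟩
  · exact Finset.disjoint_of_subset_left hTR
      (Finset.disjoint_of_subset_right hIC disjoint_compl_left)
  · exact Finset.disjoint_of_subset_left hTR
      (Finset.disjoint_of_subset_right hQC disjoint_compl_left)
  · exact fun h hh =>
      (Finset.mem_union.1 hh).elim (fun hh => (hattT h hh).1) fun hh => (hattI h hh).1
  · exact fun h hh => (Finset.mem_union.1 hh).elim (fun hh => (hattT h hh).2.1)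
      fun hh => (hattI h hh).2.1
  · exact fun h hh => (Finset.mem_union.1 hh).elim (fun hh => (hattT h hh).2.2)
      fun hh => (hattI h hh).2.2
  · exact fun z hz => houtside z ((memU z).1 hz)
  · intro z w hz hzw h hh h' hh' hhz hwh
    have hw := hzw.mem (S := (↑(T ∪ I ∪ Q) : Set V)ᶜ) hz
    rw [Set.mem_compl_iff, Finset.mem_coe] at hw
    have hz' := (memU z).1 hz
    have hw' := (memU w).1 hw
    have hyz : D.Adj y z := ((houtside z hz').resolve_right
      fun hcon => (hcon h hh).2 hhz) y (Finset.mem_union_left _ hyT) |>.1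
    have hwy : D.Adj w y := ((houtside w hw').resolve_left
      fun hcon => (hcon h' hh').2 hwh) y (Finset.mem_union_left _ hyT) |>.1
    rw [Finset.mem_sdiff, memR] at hz' hw'
    have hzw' : D.WalkIn (Set.range x)ᶜ z w := hzw.mono fun v hv => by
      rw [Set.mem_compl_iff, Finset.mem_coe, memU, Finset.mem_sdiff, memR] at hv
      exact hv.1
    exact hz'.2 ((memT z).2 ⟨hz'.1, .arc hy hz'.1 hyz, hzw'.trans (.arc hw'.1 hy hwy)⟩)

end Structure

end Digraph

/-! ### Twin blocks with at least two vertices -/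

namespace Digraph

section Blocks

variable {V : Type*} [DecidableEq V] {D : Digraph V}

theorem TwinBlocks.exists_pathOn {m : ℕ} {q : ℤ → V} {a b : ℤ} {A B : Finset V}
    (h : D.TwinBlocks m q a b A B) : ∃ u ∈ A, ∃ v ∈ A, D.PathOn u v A :=
  h.completeA.exists_pathOn h.pos

/-- Inserting `A` instead of `q (j + 1), …, q (l - 1)`, while `B` closes the path up to a cycle,
cannot be profitable. -/
theorem TwinBlocks.card_le_of_insert {m : ℕ} {q : ℤ → V} {a b : ℤ} {A B : Finset V}
    (h : D.TwinBlocks m q a b A B) {j l : ℤ} (haj : a ≤ j) (hjl : j < l) (hlb : l ≤ b) {u v : V}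
    (hp : D.PathOn u v A) (hju : D.Adj (q j) u) (hvl : D.Adj v (q l)) :
    (A.card : ℤ) ≤ l - j - 1 := by
  obtain ⟨u', hu', v', hv', hB⟩ := h.symm.exists_pathOn
  have p1 := h.line.pathOn le_rfl haj (by lia : j ≤ b)
  have p2 := h.line.pathOn (by lia : a ≤ l) hlb le_rfl
  have s1 := seg_subset q (le_refl a) (by lia : j ≤ b)
  have s2 := seg_subset q (by lia : a ≤ l) (le_refl b)
  have d1 := Finset.disjoint_of_subset_right s1 h.disjA
  have d2 := Finset.disjoint_of_subset_right s2 h.disjA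
  have d3 := Finset.disjoint_of_subset_right s1 h.disjB
  have d4 := Finset.disjoint_of_subset_right s2 h.disjB
  have d5 := h.line.seg_disjoint le_rfl le_rfl hjl
  have d := h.disj
  have p := ((p1.append hju hp d1.symm).append hvl p2
    (Finset.disjoint_union_left.2 ⟨d5, d2⟩)).append
    (h.from_last u' (Finset.mem_union_right _ hu')) hB
    (Finset.disjoint_union_left.2 ⟨Finset.disjoint_union_left.2 ⟨d3.symm, d⟩, d4.symm⟩)
  have hcard : ((seg q a j ∪ A ∪ seg q l b) ∪ B).card =
      (seg q a j).card + A.card + (seg q l b).card + B.card := by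
    rw [Finset.card_union_of_disjoint, Finset.card_union_of_disjoint,
      Finset.card_union_of_disjoint d1.symm]
    · exact Finset.disjoint_union_left.2 ⟨d5, d2⟩
    · exact Finset.disjoint_union_left.2 ⟨Finset.disjoint_union_left.2 ⟨d3.symm, d⟩, d4.symm⟩
  have c1 := h.line.card_seg le_rfl (by lia : j ≤ b)
  have c2 := h.line.card_seg (by lia : a ≤ l) (le_refl b)
  have c3 := h.card_eq
  have c4 := Finset.card_pos.2 h.pos
  have c5 := h.length
  have := h.max _ (p.hasCycle (h.to_first v' (Finset.mem_union_right _ hv')) (by lia))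
  lia

/-- All vertices of `A` dominate exactly `q a, …, q t`, and are dominated by exactly
`q t, …, q b`. -/
structure IsThreshold (D : Digraph V) (q : ℤ → V) (a b : ℤ) (A : Finset V) (t : ℤ) : Prop where
  le : a ≤ t
  ge : t ≤ b
  adj_to : ∀ h ∈ A, ∀ j, a ≤ j → j ≤ t → D.Adj h (q j)
  adj_from : ∀ h ∈ A, ∀ j, t ≤ j → j ≤ b → D.Adj (q j) h
  not_to : ∀ h ∈ A, ∀ j, t < j → j ≤ b → ¬ D.Adj h (q j)
  not_from : ∀ h ∈ A, ∀ j, a ≤ j → j < t → ¬ D.Adj (q j) h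

theorem TwinBlocks.exists_isThreshold {m : ℕ} {q : ℤ → V} {a b : ℤ} {A B : Finset V}
    (h : D.TwinBlocks m q a b A B) (hA : 2 ≤ A.card) : ∃ t, D.IsThreshold q a b A t := by
  have hxor : ∀ w ∈ A, _ := fun w hw => h.xor w (Finset.mem_union_left _ hw)
  have hfirst : ∀ w ∈ A, _ := fun w hw => h.to_first w (Finset.mem_union_left _ hw)
  have hlast : ∀ w ∈ A, _ := fun w hw => h.from_last w (Finset.mem_union_left _ hw)
  have one : ∀ j, a ≤ j → j < b → ∀ u ∈ A, ∀ v ∈ A, D.Adj (q j) u → ¬ D.Adj v (q (j + 1)) := by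
    intro j h1 h2 u hu v hv hju hvj
    by_cases huv : u = v
    · subst huv
      have := hxor u hu j h1 h2
      unfold Xor at this
      tauto
    · have := h.card_le_of_insert h1 (by lia) (by lia) (h.completeA.pathOn hu hv huv) hju hvj
      lia
  have two : ∀ j, a ≤ j → j + 2 ≤ b → ∀ u ∈ A, ∀ v ∈ A, u ≠ v → D.Adj (q j) u →
      ¬ D.Adj v (q (j + 2)) := by
    intro j h1 h2 u hu v hv huv hju hvj
    have := h.card_le_of_insert h1 (by lia) (by lia) (h.completeA.pathOn hu hv huv) hju hvj
    lia
  have uniform : ∀ j, a ≤ j → j ≤ b → ∀ u ∈ A, ∀ v ∈ A, D.Adj (q j) u → D.Adj (q j) v := by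
    intro j h1 h2 u hu v hv hju
    rcases eq_or_lt_of_le h2 with rfl | h2
    · exact hlast v hv
    · have := hxor v hv j h1 h2
      have := one j h1 h2 u hu v hv hju
      unfold Xor at *
      tauto
  obtain ⟨u₀, hu₀⟩ := h.pos
  obtain ⟨t, ⟨hat, htb, u, hu, htu⟩, htmin⟩ := Int.exists_least_of_bdd
    (P := fun j => a ≤ j ∧ j ≤ b ∧ ∃ u ∈ A, D.Adj (q j) u) ⟨a, fun z hz => hz.1⟩
    ⟨b, h.lt.le, le_rfl, u₀, hu₀, hlast u₀ hu₀⟩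
  have not_from : ∀ h ∈ A, ∀ j, a ≤ j → j < t → ¬ D.Adj (q j) h := fun w hw j h1 h2 hj => by
    have := htmin j ⟨h1, by lia, w, hw, hj⟩
    lia
  have adj_from : ∀ j, t ≤ j → j ≤ b → ∀ w ∈ A, D.Adj (q j) w := by
    intro j hj
    induction j, hj using Int.leInduction with
    | base => exact fun _ w hw => uniform t hat htb u hu w hw htu
    | succ j hj ih =>
      intro hjb w hw
      rcases eq_or_lt_of_le hjb with hjb | hjb
      · rw [hjb]; exact hlast w hw
      · obtain ⟨v, hv, hvw⟩ := Finset.exists_mem_ne hA w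
        have h1 := two j (by lia) (by lia) v hv w hw hvw (ih (by lia) v hv)
        have h2 := hxor w hw (j + 1) (by lia) hjb
        rw [add_assoc] at h2
        unfold Xor at h2
        tauto
  refine ⟨t, hat, htb, ?_, fun w hw j h1 h2 => adj_from j h1 h2 w hw, ?_, not_from⟩
  · intro w hw j h1 h2
    rcases eq_or_lt_of_le h1 with rfl | h1
    · exact hfirst w hw
    · have h3 := hxor w hw (j - 1) (by lia) (by lia)
      have h4 := not_from w hw (j - 1) (by lia) (by lia)
      rw [sub_add_cancel] at h3
      unfold Xor at h3
      tauto
  · intro w hw j h1 h2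
    have h3 := one (j - 1) (by lia) (by lia) w hw w hw (adj_from (j - 1) (by lia) (by lia) w hw)
    rwa [sub_add_cancel] at h3

/-- The block `A` can be entered from and left to a segment of the path of any size, through any
number of its vertices. -/
theorem TwinBlocks.hasCycle {m : ℕ} {q : ℤ → V} {a b : ℤ} {A B : Finset V}
    (h : D.TwinBlocks m q a b A B) (hA : 2 ≤ A.card) {r : ℕ} (hr : 2 ≤ r) (hrm : r ≤ m) :
    D.HasCycleOfLength r := by
  obtain ⟨t, ht⟩ := h.exists_isThreshold hA
  have hlen := h.length
  have hat := ht.le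
  have htb := ht.ge
  have hlt := h.lt
  -- `n` vertices are taken from the path and `r - n` from the block
  obtain ⟨n, hn1, hn2, hn3, hn4⟩ : ∃ n : ℕ, 1 ≤ n ∧ n + 1 ≤ r ∧ r ≤ n + A.card ∧
      (n : ℤ) ≤ b + 1 - a := by
    by_cases hrA : r ≤ A.card
    · exact ⟨1, by lia, by lia, by lia, by lia⟩
    · exact ⟨r - A.card, by lia, by lia, by lia, by lia⟩
  obtain ⟨i, hi1, hi2, hi3, hi4⟩ : ∃ i, a ≤ i ∧ i ≤ t ∧ t ≤ i + n - 1 ∧ i + n - 1 ≤ b := by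
    by_cases h1 : t ≤ b + 1 - n
    · exact ⟨t, by lia, by lia, by lia, by lia⟩
    · exact ⟨b + 1 - n, by lia, by lia, by lia, by lia⟩
  obtain ⟨A', hA', hcard⟩ := Finset.exists_subset_card_eq (show r - n ≤ A.card by lia)
  obtain ⟨u, hu, v, hv, hp⟩ := (h.completeA.mono hA').exists_pathOn
    (Finset.card_pos.1 (by lia))
  have d : Disjoint (seg q i (i + n - 1)) A' := Finset.disjoint_of_subset_left
    (seg_subset q hi1 hi4) (Finset.disjoint_of_subset_right hA' h.disjA.symm)
  have c1 := h.line.card_seg hi1 hi4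
  have hc : (seg q i (i + n - 1) ∪ A').card = r := by
    rw [Finset.card_union_of_disjoint d]; lia
  have := ((h.line.pathOn hi1 (by lia) hi4).append
    (ht.adj_from u (hA' hu) _ hi3 hi4) hp d).hasCycle (ht.adj_to v (hA' hv) i hi1 hi2) (by lia)
  rwa [hc] at this

/-- There is an arc from `a` to `b`, or a longer walk all of whose inner vertices avoid `U`. -/
def Ear (D : Digraph V) (U : Set V) (a b : V) : Prop :=
  D.Adj a b ∨ ∃ w w', w ∉ U ∧ w' ∉ U ∧ D.Adj a w ∧ D.WalkIn Uᶜ w w' ∧ D.Adj w' b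

theorem PathOn.exists_hasCycle_of_ear {u v : V} {s : Finset V} (h : D.PathOn u v s) {U : Set V}
    (hs : (↑s : Set V) ⊆ U) (hear : D.Ear U v u) (h2 : 2 ≤ s.card) :
    ∃ k, s.card ≤ k ∧ D.HasCycleOfLength k := by
  rcases hear with hvu | ⟨w, w', hw, hw', hvw, hww', hwu⟩
  · exact ⟨_, le_rfl, h.hasCycle hvu h2⟩
  · obtain ⟨t, ht, hp⟩ := hww'.exists_pathOn hw'
    have hd : Disjoint s t := by
      rw [Finset.disjoint_left]
      exact fun z hz hz' => ht hz' (hs hz)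
    refine ⟨_, ?_, (h.append hvw hp hd).hasCycle hwu ?_⟩ <;>
      rw [Finset.card_union_of_disjoint hd] <;> lia

/-- A walk from `X` to `Y` that avoids `c` contains an ear from `X` to `Y`, if `X`, `Y` and `c`
make up all of `U`. -/
theorem exists_ear {U X Y : Set V} {c : V} (hU : ∀ v ∈ U, v ∈ X ∨ v ∈ Y ∨ v = c) {v b : V}
    (hwalk : Relation.ReflTransGen (fun u v => D.Adj u v ∧ u ≠ c ∧ v ≠ c) v b) (hb : b ∈ Y) :
    (v ∈ X → v ∉ Y → ∃ a ∈ X, ∃ b ∈ Y, D.Ear U a b) ∧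
    (v ∉ U → (∃ a ∈ X, ∃ b ∈ Y, D.Ear U a b) ∨ v ∈ Y ∨
      ∃ w, w ∉ U ∧ D.WalkIn Uᶜ v w ∧ ∃ b ∈ Y, D.Adj w b) := by
  induction hwalk using Relation.ReflTransGen.head_induction_on with
  | refl => exact ⟨fun _ h => absurd hb h, fun _ => .inr (.inl hb)⟩
  | @head v v' hvv' _ ih =>
    obtain ⟨ih1, ih2⟩ := ih
    obtain ⟨hadj, -, hv'c⟩ := hvv'
    by_cases hY : v' ∈ Y
    · exact ⟨fun hv _ => ⟨v, hv, v', hY, .inl hadj⟩,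
        fun hv => .inr (.inr ⟨v, hv, .refl, v', hY, hadj⟩)⟩
    by_cases hX : v' ∈ X
    · exact ⟨fun _ _ => ih1 hX hY, fun _ => .inl (ih1 hX hY)⟩
    have hU' : v' ∉ U := fun h => by
      rcases hU v' h with h | h | h
      exacts [hX h, hY h, hv'c h]
    rcases ih2 hU' with h | h | ⟨w, hw, hvw, b, hb, hwb⟩
    · exact ⟨fun _ _ => h, fun _ => .inl h⟩
    · exact absurd h hY
    · exact ⟨fun hv _ => ⟨v, hv, b, hb, .inr ⟨v', w, hU', hw, hadj, hvw, hwb⟩⟩,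
        fun hv => .inr (.inr ⟨w, hw, .head ⟨hv, hU', hadj⟩ hvw, b, hb, hwb⟩)⟩

variable [Fintype V]

theorem KStronglyConnected.reflTransGen (h : D.KStronglyConnected 2) {c u v : V} (hu : u ≠ c)
    (hv : v ≠ c) (huv : u ≠ v) :
    Relation.ReflTransGen (fun u v => D.Adj u v ∧ u ≠ c ∧ v ≠ c) u v := by
  have h1 := h.2 {c} (by simp) ⟨u, by simpa using hu⟩ ⟨v, by simpa using hv⟩ (by simpa using huv)
  exact Relation.ReflTransGen.lift (Subtype.val) (fun a b hab => ⟨hab, by simpa using a.2,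
    by simpa using b.2⟩) _ _ h1

/-- If the threshold `s` of `B` is at least that of `A`, then the removal of the vertex `q s`
destroys strong connectivity: either `q b` can no longer be reached from `B`, or `B` can no longer
be reached from `q a`. -/
theorem TwinBlocks.not_kStronglyConnected_of_le {m : ℕ} {q : ℤ → V} {a b : ℤ} {A B : Finset V}
    (h : D.TwinBlocks m q a b A B) {t s : ℤ} (ht : D.IsThreshold q a b A t)
    (hs : D.IsThreshold q a b B s) (hts : t ≤ s) : ¬ D.KStronglyConnected 2 := by
  intro hD
  have hline := h.line
  have hlt := h.lt
  have hlen := h.length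
  have hpos := Finset.card_pos.2 h.pos
  have hcB := h.card_eq
  have hat := ht.le
  have hsb := hs.ge
  obtain ⟨u, hu, v, hv, hpA⟩ := h.exists_pathOn
  obtain ⟨u', hu', v', hv', hpB⟩ := h.symm.exists_pathOn
  have hA : ∀ {w}, w ∈ A → w ∈ A ∪ B := fun hw => Finset.mem_union_left _ hw
  have hB : ∀ {w}, w ∈ B → w ∈ A ∪ B := fun hw => Finset.mem_union_right _ hw
  have nB : ∀ {i w}, w ∈ B → a ≤ i → i ≤ b → w ≠ q i := fun hw h1 h2 he =>
    Finset.disjoint_left.1 h.disjB hw (he ▸ mem_seg_of h1 h2)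
  set U : Finset V := A ∪ B ∪ seg q a b with hUdef
  have segU : ∀ {i j}, a ≤ i → j ≤ b → seg q i j ⊆ U := fun h1 h2 =>
    (seg_subset q h1 h2).trans Finset.subset_union_right
  have AU : A ⊆ U := Finset.subset_union_left.trans Finset.subset_union_left
  have BU : B ⊆ U := Finset.subset_union_right.trans Finset.subset_union_left
  have dA : ∀ {i j}, a ≤ i → j ≤ b → Disjoint A (seg q i j) := fun h1 h2 =>
    Finset.disjoint_of_subset_right (seg_subset q h1 h2) h.disjA
  have dB : ∀ {i j}, a ≤ i → j ≤ b → Disjoint B (seg q i j) := fun h1 h2 =>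
    Finset.disjoint_of_subset_right (seg_subset q h1 h2) h.disjB
  by_cases hsb' : s < b
  · -- ears from the vertices before `q s` and the blocks to the vertices after `q s`
    obtain ⟨e, he, f, ⟨j, hj1, hj2, rfl⟩, hear⟩ :
        ∃ e ∈ {e | e ∈ A ∪ B ∨ ∃ i, a ≤ i ∧ i < s ∧ q i = e},
        ∃ f ∈ {f | ∃ j, s < j ∧ j ≤ b ∧ q j = f}, D.Ear (↑U) e f := by
      refine (exists_ear (c := q s) (Y := {f | ∃ j, s < j ∧ j ≤ b ∧ q j = f}) ?_
        (hD.reflTransGen (nB hu' (by lia) hsb)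
        (fun he => ?_) (nB hu' hlt.le le_rfl)) ⟨b, hsb', le_rfl, rfl⟩).1 (.inl (hB hu')) ?_
      · intro z hz
        rcases Finset.mem_union.1 (Finset.mem_coe.1 hz) with hz | hz
        · exact .inl (.inl hz)
        · obtain ⟨k, h1, h2, rfl⟩ := mem_seg.1 hz
          rcases lt_trichotomy k s with h3 | rfl | h3
          · exact .inl (.inr ⟨k, h1, h3, rfl⟩)
          · exact .inr (.inr rfl)
          · exact .inr (.inl ⟨k, h3, h2, rfl⟩)
      · have := hline.inj b s (by lia) le_rfl (by lia) (by lia) he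
        lia
      · rintro ⟨j, h1, h2, h3⟩
        exact nB hu' (by lia) h2 h3.symm
    rcases he with he | ⟨i, hi1, hi2, rfl⟩
    · -- the ear starts in a block: it serves to insert a vertex of `B` before `q j`
      have hear' : D.Ear (↑U) u' (q j) := by
        rcases hear with hadj | ⟨w, w', hw, hw', hew, hww', hwj⟩
        · rcases Finset.mem_union.1 he with he | he
          · exact absurd hadj (ht.not_to e he j (by lia) hj2)
          · exact absurd hadj (hs.not_to e he j hj1 hj2)
        · refine .inr ⟨w, w', hw, hw', ?_, hww', hwj⟩
          exact (((h.outside w hw).resolve_right fun hcon => (hcon e he).2 hew) u' (hB hu')).1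
      have d1 := h.line.seg_disjoint (i := a) (j := j - 1) (i' := j) (j' := b) le_rfl le_rfl (by lia)
      have d2 : Disjoint (seg q j b) A := (dA (by lia) le_rfl).symm
      have d3 : Disjoint (seg q j b ∪ A) (seg q a (j - 1)) :=
        Finset.disjoint_union_left.2 ⟨d1.symm, dA le_rfl (by lia)⟩
      have d4 : Disjoint (seg q j b ∪ A ∪ seg q a (j - 1)) {u'} := by
        rw [Finset.disjoint_singleton_right, Finset.mem_union, Finset.mem_union]
        rintro ((hm | hm) | hm)
        · exact Finset.disjoint_left.1 (dB (by lia) le_rfl) hu' hm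
        · exact Finset.disjoint_left.1 h.disj hm hu'
        · exact Finset.disjoint_left.1 (dB le_rfl (by lia)) hu' hm
      have p := (((hline.pathOn (by lia) hj2 le_rfl).append (h.from_last u (hA hu)) hpA d2).append
        (h.to_first v (hA hv)) (hline.pathOn le_rfl (by lia) (by lia)) d3).append
        (hs.adj_from u' hu' (j - 1) (by lia) (by lia)) (.single u') d4
      have hc : (seg q j b ∪ A ∪ seg q a (j - 1) ∪ {u'}).card = m + 1 := by
        rw [Finset.card_union_of_disjoint d4, Finset.card_union_of_disjoint d3,
          Finset.card_union_of_disjoint d2, hline.card_seg (by lia) le_rfl,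
          hline.card_seg le_rfl (by lia), Finset.card_singleton]
        lia
      obtain ⟨k, hk, hk'⟩ := p.exists_hasCycle_of_ear (U := ↑U) (by
        rw [Finset.coe_subset]
        exact Finset.union_subset (Finset.union_subset (Finset.union_subset (segU (by lia) le_rfl) AU)
          (segU le_rfl (by lia))) (by simpa using BU hu')) hear' (by lia)
      have := h.max k hk'
      lia
    · -- the ear jumps over `q s`: both blocks can be inserted
      have d1 : Disjoint (seg q j b) B := (dB (by lia) le_rfl).symm
      have d2 : Disjoint (seg q j b ∪ B) (seg q (i + 1) (j - 1)) :=
        Finset.disjoint_union_left.2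
          ⟨(hline.seg_disjoint (by lia) le_rfl (by lia)).symm, dB (by lia) (by lia)⟩
      have d3 : Disjoint (seg q j b ∪ B ∪ seg q (i + 1) (j - 1)) A :=
        Finset.disjoint_union_left.2 ⟨Finset.disjoint_union_left.2
          ⟨(dA (by lia) le_rfl).symm, h.disj.symm⟩, (dA (by lia) (by lia)).symm⟩
      have d4 : Disjoint (seg q j b ∪ B ∪ seg q (i + 1) (j - 1) ∪ A) (seg q a i) :=
        Finset.disjoint_union_left.2 ⟨Finset.disjoint_union_left.2 ⟨Finset.disjoint_union_left.2
          ⟨(hline.seg_disjoint le_rfl le_rfl (by lia)).symm, dB le_rfl (by lia)⟩,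
          (hline.seg_disjoint le_rfl (by lia) (by lia)).symm⟩, dA le_rfl (by lia)⟩
      have p := ((((hline.pathOn (by lia) hj2 le_rfl).append (h.from_last u' (hB hu')) hpB d1).append
        (hs.adj_to v' hv' (i + 1) (by lia) (by lia))
        (hline.pathOn (by lia) (by lia) (by lia)) d2).append
        (ht.adj_from u hu (j - 1) (by lia) (by lia)) hpA d3).append
        (h.to_first v (hA hv)) (hline.pathOn le_rfl hi1 (by lia)) d4
      have hc : (seg q j b ∪ B ∪ seg q (i + 1) (j - 1) ∪ A ∪ seg q a i).card = m + B.card := by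
        rw [Finset.card_union_of_disjoint d4, Finset.card_union_of_disjoint d3,
          Finset.card_union_of_disjoint d2, Finset.card_union_of_disjoint d1,
          hline.card_seg (by lia) le_rfl, hline.card_seg (by lia) (by lia),
          hline.card_seg le_rfl (by lia)]
        lia
      obtain ⟨k, hk, hk'⟩ := p.exists_hasCycle_of_ear (U := ↑U) (by
        rw [Finset.coe_subset]
        exact Finset.union_subset (Finset.union_subset (Finset.union_subset (Finset.union_subset
          (segU (by lia) le_rfl) BU) (segU (by lia) (by lia))) AU) (segU le_rfl (by lia)))
        hear (by lia)
      have := h.max k hk'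
      lia
  · -- now `s = b`: ears from the vertices before `q b` and `A` to `B`
    obtain rfl : s = b := by lia
    obtain ⟨e, he, f, hf, hear⟩ : ∃ e ∈ {e | e ∈ A ∨ ∃ i, a ≤ i ∧ i < s ∧ q i = e},
        ∃ f ∈ {f | f ∈ B}, D.Ear (↑U) e f := by
      refine (exists_ear (c := q s) (Y := {f | f ∈ B}) ?_ (hD.reflTransGen (fun he => ?_)
        (nB hu' (by lia) hsb) (nB hu' le_rfl hlt.le).symm) hu').1 (.inr ⟨a, le_rfl, hlt, rfl⟩) ?_
      · intro z hz
        rcases Finset.mem_union.1 (Finset.mem_coe.1 hz) with hz | hz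
        · rcases Finset.mem_union.1 hz with hz | hz
          exacts [.inl (.inl hz), .inr (.inl hz)]
        · obtain ⟨k, h1, h2, rfl⟩ := mem_seg.1 hz
          rcases eq_or_lt_of_le h2 with rfl | h3
          · exact .inr (.inr rfl)
          · exact .inl (.inr ⟨k, h1, h3, rfl⟩)
      · have := hline.inj a s le_rfl (by lia) (by lia) (by lia) he
        lia
      · exact fun hm => nB hm le_rfl hlt.le rfl
    rcases he with he | ⟨i, hi1, hi2, rfl⟩
    · rcases hear with hadj | ⟨w, w', hw, hw', hew, hww', hwf⟩
      · exact (h.not_adj e he f hf).1 hadj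
      · exact h.no_return w w' hw hww' e (hA he) f (hB hf) hew hwf
    · have d0 : f ∉ seg q (i + 1) s := fun hm => Finset.disjoint_left.1 (dB (by lia) le_rfl) hf hm
      have d2 : Disjoint (insert f (seg q (i + 1) s)) A := by
        rw [Finset.disjoint_insert_left]
        exact ⟨fun hm => Finset.disjoint_left.1 h.disj hm hf, (dA (by lia) le_rfl).symm⟩
      have d3 : Disjoint (insert f (seg q (i + 1) s) ∪ A) (seg q a i) := by
        rw [Finset.disjoint_union_left, Finset.disjoint_insert_left]
        exact ⟨⟨fun hm => Finset.disjoint_left.1 (dB le_rfl (by lia)) hf hm,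
          (hline.seg_disjoint le_rfl le_rfl (by lia)).symm⟩, dA le_rfl (by lia)⟩
      have p := ((PathOn.cons (hs.adj_to f hf (i + 1) (by lia) (by lia))
        (hline.pathOn (by lia) (by lia) le_rfl) d0).append (h.from_last u (hA hu)) hpA d2).append
        (h.to_first v (hA hv)) (hline.pathOn le_rfl hi1 (by lia)) d3
      have hc : (insert f (seg q (i + 1) s) ∪ A ∪ seg q a i).card = m + 1 := by
        rw [Finset.card_union_of_disjoint d3, Finset.card_union_of_disjoint d2,
          Finset.card_insert_of_notMem d0, hline.card_seg (by lia) le_rfl,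
          hline.card_seg le_rfl (by lia)]
        lia
      obtain ⟨k, hk, hk'⟩ := p.exists_hasCycle_of_ear (U := ↑U) (by
        rw [Finset.coe_subset]
        exact Finset.union_subset (Finset.union_subset (Finset.insert_subset (BU hf)
          (segU (by lia) le_rfl)) AU) (segU le_rfl (by lia))) hear (by lia)
      have := h.max k hk'
      lia

theorem TwinBlocks.not_kStronglyConnected {m : ℕ} {q : ℤ → V} {a b : ℤ} {A B : Finset V}
    (h : D.TwinBlocks m q a b A B) (hA : 2 ≤ A.card) : ¬ D.KStronglyConnected 2 := by
  obtain ⟨t, ht⟩ := h.exists_isThreshold hA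
  obtain ⟨s, hs⟩ := h.symm.exists_isThreshold (by rw [h.card_eq]; exact hA)
  rcases le_total t s with hts | hts
  · exact h.not_kStronglyConnected_of_le ht hs hts
  · exact h.symm.not_kStronglyConnected_of_le hs ht hts

/-! ### Cycles without bypasses -/

theorem exists_enters {x : ℤ → V} {y : V} (hy : y ∉ Set.range x) {r : V → V → Prop}
    (hr : ∀ u v, r u v → D.Adj u v) {i : ℤ} (h : Relation.ReflTransGen r (x i) y) :
    ∃ j v, r (x j) v ∧ D.Enters x y j := by
  obtain ⟨u, v, ⟨j, rfl⟩, hv, huv, hw⟩ := exists_last_exit (P := (· ∈ Set.range x)) h ⟨i, rfl⟩ hy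
  exact ⟨j, v, huv, v, hv, hr _ _ huv,
    Relation.ReflTransGen.mono (fun a b hab => ⟨hab.1, hab.2.1, hr _ _ hab.2.2⟩) _ _ hw⟩

theorem exists_exits {x : ℤ → V} {y : V} (hy : y ∉ Set.range x) {r : V → V → Prop}
    (hr : ∀ u v, r u v → D.Adj u v) {i : ℤ} (h : Relation.ReflTransGen r y (x i)) :
    ∃ j u, r u (x j) ∧ D.Exits x y j := by
  obtain ⟨u, v, hu, ⟨j, rfl⟩, huv, hw⟩ := exists_first_entry (P := (· ∈ Set.range x)) h hy ⟨i, rfl⟩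
  exact ⟨j, u, huv, u, hu,
    Relation.ReflTransGen.mono (fun a b hab => ⟨hab.1, hab.2.1, hr _ _ hab.2.2⟩) _ _ hw,
    hr _ _ huv⟩

/-- `y` lies on a bypass of the cycle `x`: a walk leaving the cycle, going through `y` and returning
to a different vertex of the cycle. -/
def OnBypass (D : Digraph V) (m : ℕ) (x : ℤ → V) (y : V) : Prop :=
  ∃ i j, ¬ (m : ℤ) ∣ i - j ∧ D.Enters x y i ∧ D.Exits x y j

theorem Enters.congr {m : ℕ} {x : ℤ → V} (hc : D.IsCyc m x) {y : V} {i j : ℤ}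
    (hij : (m : ℤ) ∣ i - j) (h : D.Enters x y i) : D.Enters x y j := by
  unfold Enters at *
  rwa [(hc.eq_iff i j).2 hij] at h

theorem Exits.congr {m : ℕ} {x : ℤ → V} (hc : D.IsCyc m x) {y : V} {i j : ℤ}
    (hij : (m : ℤ) ∣ i - j) (h : D.Exits x y i) : D.Exits x y j := by
  unfold Exits at *
  rwa [(hc.eq_iff i j).2 hij] at h

/-- A bypass with minimal gap. -/
theorem OnBypass.exists_min {m : ℕ} {x : ℤ → V} (hc : D.IsCyc m x) {y : V}
    (h : D.OnBypass m x y) :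
    ∃ i g : ℤ, 0 < g ∧ g < m ∧ D.Enters x y i ∧ D.Exits x y (i + g) ∧
      ∀ j g', 0 < g' → g' < g → D.Enters x y j → ¬ D.Exits x y (j + g') := by
  obtain ⟨i, j, hij, hi, hj⟩ := h
  obtain ⟨j', h1, h2, -, h4⟩ := hc.exists_rep j i
  have hne : j' ≠ i := by
    rintro rfl
    exact hij h4
  obtain ⟨g, ⟨hg, hgm, i, hi, hj⟩, hmin⟩ := Int.exists_least_of_bdd
    (P := fun g : ℤ => 0 < g ∧ g < m ∧ ∃ i, D.Enters x y i ∧ D.Exits x y (i + g))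
    ⟨0, fun z hz => hz.1.le⟩
    ⟨j' - i, by lia, by lia, i, hi, by
      rw [add_sub_cancel]
      exact hj.congr hc ((dvd_sub_comm).1 h4)⟩
  refine ⟨i, g, hg, hgm, hi, hj, fun j g' h1 h2 h3 h4 => ?_⟩
  have := hmin g' ⟨h1, by lia, j, h3, h4⟩
  lia

theorem KStronglyConnected.onBypass (h : D.KStronglyConnected 2) {m : ℕ} {x : ℤ → V}
    (hc : D.IsCyc m x) {y : V} (hy : y ∉ Set.range x) : D.OnBypass m x y := by
  have hne : ∀ i, x i ≠ y := fun i hi => hy ⟨i, hi⟩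
  have hm := hc.two_le
  obtain ⟨j, -, -, hj⟩ := exists_exits hy (fun u v huv => huv.1)
    (h.reflTransGen (c := x 1) (hne 1).symm (hc.ne (by lia) (by lia)) (hne 0).symm)
  obtain ⟨i, v, hv, hi⟩ := exists_enters hy (fun u v huv => huv.1)
    (h.reflTransGen (c := x j) (u := x (j + 1)) (hc.ne (by lia) (by lia)).symm (hne j).symm
      (hne _))
  exact ⟨i, j, fun hd => hv.2.1 ((hc.eq_iff _ _).2 hd), hi, hj⟩

/-- If no vertex lies on a bypass, then everything outside the cycle that is attached at the same
vertex of the cycle as `y` forms a set `K` of at least `(p - 1) / 2` vertices, and the degrees of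
the vertices outside `K` force its complement, which contains the cycle, to be a clique. -/
theorem hasCycle_of_not_onBypass (hl : D.Loopless)
    (hdeg : ∀ v, Fintype.card V ≤ D.degOn v Finset.univ + 1) (hstrong : D.StronglyConnected)
    {m : ℕ} {x : ℤ → V} (hc : D.IsCyc m x) {y : V} (hy : y ∉ Set.range x)
    (hno : ∀ z, z ∉ Set.range x → ¬ D.OnBypass m x z) {r : ℕ} (hr : 2 ≤ r) (hrm : r ≤ m) :
    D.HasCycleOfLength r := by
  classical
  have hm := hc.two_le
  have hne : ∀ z, z ∉ Set.range x → ∀ i, x i ≠ z := fun z hz i hi => hz ⟨i, hi⟩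
  have henters : ∀ z, z ∉ Set.range x → ∃ i, D.Enters x z i := fun z hz => by
    obtain ⟨i, _, _, hi⟩ := exists_enters hz (fun u v huv => huv)
      (hstrong (x 0) z (hne z hz 0))
    exact ⟨i, hi⟩
  have hexits : ∀ z, z ∉ Set.range x → ∃ i, D.Exits x z i := fun z hz => by
    obtain ⟨i, _, _, hi⟩ := exists_exits hz (fun u v huv => huv)
      (hstrong z (x 0) (hne z hz 0).symm)
    exact ⟨i, hi⟩
  have huniq : ∀ z, z ∉ Set.range x → ∀ i j, D.Enters x z i → D.Exits x z j →
      (m : ℤ) ∣ i - j := fun z hz i j hi hj => by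
    by_contra hd
    exact hno z hz ⟨i, j, hd, hi, hj⟩
  obtain ⟨c, hcy⟩ := henters y hy
  -- the vertices attached at `x c`
  let K : Finset V := Finset.univ.filter fun z => z ∉ Set.range x ∧ D.Enters x z c
  have memK : ∀ z, z ∈ K ↔ z ∉ Set.range x ∧ D.Enters x z c := fun z => by
    rw [Finset.mem_filter]; simp
  have hKexit : ∀ z ∈ K, ∀ j, D.Exits x z j → (m : ℤ) ∣ c - j := fun z hz j hj =>
    huniq z ((memK z).1 hz).1 c j ((memK z).1 hz).2 hj
  have hKenter : ∀ z ∈ K, ∀ i, D.Enters x z i → (m : ℤ) ∣ i - c := fun z hz i hi => by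
    obtain ⟨j, hj⟩ := hexits z ((memK z).1 hz).1
    have h1 := hKexit z hz j hj
    have h2 := huniq z ((memK z).1 hz).1 i j hi hj
    rw [show i - c = (i - j) - (c - j) by ring]
    exact dvd_sub h2 h1
  have hsep : ∀ z ∈ K, ∀ v, v ∉ K → v ≠ x c → ¬ D.Adj z v ∧ ¬ D.Adj v z := by
    intro z hz v hv hvc
    have hzR := ((memK z).1 hz).1
    by_cases hvx : v ∈ Set.range x
    · obtain ⟨i, rfl⟩ := hvx
      refine ⟨fun h => hvc ?_, fun h => hvc ?_⟩
      · exact ((hc.eq_iff _ _).2 (hKexit z hz i ⟨z, hzR, .refl, h⟩)).symm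
      · exact (hc.eq_iff _ _).2 (hKenter z hz i ⟨z, hzR, h, .refl⟩)
    · refine ⟨fun h => hv ?_, fun h => hv ?_⟩
      · obtain ⟨u, hu, hcu, huz⟩ := ((memK z).1 hz).2
        exact (memK v).2 ⟨hvx, u, hu, hcu, huz.trans (.arc hzR hvx h)⟩
      · obtain ⟨i, u, hu, hiu, huv⟩ := henters v hvx
        have h1 := hKenter z hz i ⟨u, hu, hiu, huv.trans (.arc hvx hzR h)⟩
        exact (memK v).2 ⟨hvx, Enters.congr hc h1 ⟨u, hu, hiu, huv⟩⟩
  have hsplit : ∀ v, D.degOn v Finset.univ = D.degOn v K + D.degOn v Kᶜ := fun v => by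
    rw [← degOn_union disjoint_compl_right, Finset.union_compl]
  have hcard : K.card + Kᶜ.card = Fintype.card V := Finset.card_add_card_compl K
  have hxc : x c ∉ K := fun h => ((memK _).1 h).1 ⟨c, rfl⟩
  have hyK : y ∈ K := (memK y).2 ⟨hy, hcy⟩
  have hK : Fintype.card V ≤ 2 * K.card + 1 := by
    have h1 := hdeg y
    have h2 := degOn_add_two_le hl hyK
    have h3 : D.degOn y Kᶜ ≤ 2 := by
      unfold degOn
      rw [← Finset.add_sum_erase _ _ (Finset.mem_compl.2 hxc), Finset.sum_eq_zero]
      · exact link_le_two _ _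
      · intro v hv
        rw [Finset.mem_erase, Finset.mem_compl] at hv
        have := hsep y hyK v hv.2 hv.1
        simp [link, arc_of_not_adj this.1, arc_of_not_adj this.2]
    rw [hsplit] at h1
    lia
  have hout : ∀ v, v ∉ K → v ≠ x c → Fintype.card V ≤ D.degOn v Kᶜ + 1 := fun v hv hvc => by
    have h1 := hdeg v
    have h2 : D.degOn v K = 0 := Finset.sum_eq_zero fun z hz => by
      have := hsep z hz v hv hvc
      simp [link, arc_of_not_adj this.1, arc_of_not_adj this.2]
    rw [hsplit] at h1
    lia
  have hfull : ∀ v, v ∉ K → v ≠ x c → ∀ w, w ∉ K → w ≠ v → D.Adj v w ∧ D.Adj w v := by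
    intro v hv hvc w hw hwv
    refine adj_of_two_mul_card_le (s := Kᶜ.erase v) ?_ (by simp [hw, hwv])
    have h1 := hout v hv hvc
    rw [degOn_erase hl, Finset.card_erase_of_mem (by simpa using hv)]
    lia
  have hcomp : D.IsCompleteOn Kᶜ := fun u hu v hv huv => by
    rw [Finset.mem_compl] at hu hv
    by_cases huc : u = x c
    · exact (hfull v hv (fun h => huv (huc.trans h.symm)) u hu huv).2
    · exact (hfull u hu huc v hv huv.symm).1
  refine hcomp.hasCycle hr (hrm.trans ?_)
  have hsub : seg x 0 (0 + m - 1) ⊆ Kᶜ := fun v hv => by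
    rw [Finset.mem_compl, memK]
    exact fun h => h.1 ((hc.mem_seg_iff_range 0).1 hv)
  have := Finset.card_le_card hsub
  rw [(hc.isLine (a := 0) (b := 0 + m - 1) (by lia)).card_seg le_rfl le_rfl] at this
  lia

end Blocks

end Digraph

/-! ### Single vertices outside a longest cycle -/

namespace Digraph

section Hubs

/-- An `m`-periodic predicate on the integers that is preserved by a shift by `e` only depends on
the argument modulo `gcd e m`. -/
theorem iff_of_gcd_dvd {P : ℤ → Prop} {m : ℕ} (hm : 0 < m) {e : ℤ} (hP : ∀ i, P (i + m) ↔ P i)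
    (he : ∀ i, P i → P (i + e)) {i j : ℤ} (hij : (Int.gcd e m : ℤ) ∣ i - j) : P i ↔ P j := by
  have hmul : ∀ (n : ℕ) i, P i → P (i + n * e) := by
    intro n
    induction n with
    | zero => intro i hi; simpa using hi
    | succ n ih =>
      intro i hi
      have := he _ (ih i hi)
      rwa [show i + ((n + 1 : ℕ) : ℤ) * e = i + n * e + e by push_cast; ring]
  have hper : ∀ (n : ℕ) i, P (i + n * m) ↔ P i := by
    intro n
    induction n with
    | zero => intro i; simp
    | succ n ih =>
      intro i
      rw [show i + ((n + 1 : ℕ) : ℤ) * m = i + n * m + m by push_cast; ring, hP, ih]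
  have hper' : ∀ (l : ℤ) i, P (i + l * m) ↔ P i := by
    intro l i
    obtain ⟨n, rfl | rfl⟩ := l.eq_nat_or_neg
    · exact hper n i
    · rw [← hper n (i + -n * m), show i + -(n : ℤ) * m + n * m = i by ring]
  have key : ∀ i j, (Int.gcd e m : ℤ) ∣ i - j → P i → P j := by
    intro i j hij hi
    obtain ⟨k, l, hkl⟩ : ∃ k l, j - i = e * k + m * l := by
      obtain ⟨t, ht⟩ := dvd_sub_comm.1 hij
      exact ⟨Int.gcdA e m * t, Int.gcdB e m * t, by rw [ht, Int.gcd_eq_gcd_ab]; ring⟩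
    -- adding a multiple of `m` makes the coefficient of `e` nonnegative
    have h1 := hmul (k + |k| * m).toNat i hi
    have h0 : 0 ≤ k + |k| * m := by
      have := neg_abs_le k
      have := abs_nonneg k
      nlinarith
    rw [Int.toNat_of_nonneg h0] at h1
    rw [← hper' (|k| * e - l)]
    convert h1 using 1
    lia
  exact ⟨key i j hij, key j i (dvd_sub_comm.1 hij)⟩

variable {V : Type*} [DecidableEq V] {D : Digraph V}

/-- For each `i`, exactly one of the arcs from `x i` to `v` and from `v` to `x (i + 1)` is
present. -/
def Splits (D : Digraph V) (x : ℤ → V) (v : V) : Prop :=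
  ∀ i, Xor (D.Adj (x i) v) (D.Adj v (x (i + 1)))

theorem Splits.adj_iff {x : ℤ → V} {v : V} (h : D.Splits x v) (i : ℤ) :
    D.Adj (x i) v ↔ ¬ D.Adj v (x (i + 1)) := by
  have := h i
  unfold Xor at this
  tauto

/-- If `D` has no cycle of length `e + 1`, then the out-neighbourhood on a cycle of a vertex that
splits the cycle is invariant under the shift by `e`. -/
theorem Splits.shift {m : ℕ} {x : ℤ → V} (hc : D.IsCyc m x) {y : V} (hy : y ∉ Set.range x)
    (hs : D.Splits x y) {e : ℕ} (he : 1 ≤ e) (hem : e < m) (hno : ¬ D.HasCycleOfLength (e + 1))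
    (i : ℤ) (hi : D.Adj y (x i)) : D.Adj y (x (i + e)) := by
  by_contra hcon
  have hl : D.IsLine x i (i + e - 1) := hc.isLine (by lia)
  have hy' : y ∉ seg x i (i + e - 1) := fun h => by
    obtain ⟨k, _, _, rfl⟩ := mem_seg.1 h
    exact hy ⟨k, rfl⟩
  have hcard : (insert y (seg x i (i + e - 1))).card = e + 1 := by
    rw [Finset.card_insert_of_notMem hy', hl.card_seg le_rfl le_rfl]; lia
  have hadj := (hs.adj_iff (i + e - 1)).2 (by rwa [sub_add_cancel])
  have := (PathOn.cons hi (hl.pathOn le_rfl (by lia) le_rfl) hy').hasCycle hadj (by lia)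
  rw [hcard] at this
  exact hno this

/-- Two vertices `u` and `v` that split the cycle and may occur on it only at the position `j`.
If the first alternative fails at `a` and the second one at `c`, then, after shifts of `a` and `c`
by multiples of `gcd e m`, `u, x a, v, x c, …, x (c + e - 3)` is a cycle of length `e + 1`. -/
theorem shift_or_shift {m : ℕ} {x : ℤ → V} (hc : D.IsCyc m x) {u v : V} {j : ℤ} {e : ℕ}
    (he : 3 ≤ e) (hem : e < m) (hno : ¬ D.HasCycleOfLength (e + 1))
    (hu : ∀ i, x i = u → (m : ℤ) ∣ i - j) (hv : ∀ i, x i = v → (m : ℤ) ∣ i - j) (huv : u ≠ v)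
    (hsu : D.Splits x u) (hsv : D.Splits x v)
    (heu : ∀ i, D.Adj u (x i) → D.Adj u (x (i + e)))
    (hev : ∀ i, D.Adj v (x i) → D.Adj v (x (i + e))) (huj : ¬ D.Adj u (x j)) :
    (∀ a, D.Adj u (x a) → D.Adj v (x (a + 1))) ∨ (∀ c, D.Adj v (x c) → D.Adj u (x (c - 2))) := by
  by_contra! hcon
  obtain ⟨⟨a, ha, ha'⟩, c, hc1, hc2⟩ := hcon
  have hm : 0 < m := by lia
  have hperu : ∀ i, D.Adj u (x (i + m)) ↔ D.Adj u (x i) := fun i => by rw [hc.add_period]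
  have hperv : ∀ i, D.Adj v (x (i + m)) ↔ D.Adj v (x i) := fun i => by rw [hc.add_period]
  set d : ℤ := (Int.gcd e m : ℤ) with hd
  have hde : d ∣ e := Int.gcd_dvd_left ..
  have hdm : d ∣ m := Int.gcd_dvd_right ..
  have hd0 : 0 < d := by
    rw [hd]
    exact Int.natCast_pos.2 (Int.gcd_pos_iff.2 (.inr (show (m : ℤ) ≠ 0 by lia)))
  have hdle : d ≤ m - e := Int.le_of_dvd (by lia) (dvd_sub hdm hde)
  have Pu : ∀ {i k}, d ∣ i - k → (D.Adj u (x i) ↔ D.Adj u (x k)) :=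
    fun h => iff_of_gcd_dvd (P := fun i => D.Adj u (x i)) hm hperu heu h
  have Pv : ∀ {i k}, d ∣ i - k → (D.Adj v (x i) ↔ D.Adj v (x k)) :=
    fun h => iff_of_gcd_dvd (P := fun i => D.Adj v (x i)) hm hperv hev h
  -- a window of length `d` after the segment contains both `j` and a shift of `a`
  obtain ⟨w, hw1, hw2, hw3⟩ : ∃ w, w ≤ j ∧ j < w + d ∧ d ∣ w - (c - 2) := by
    refine ⟨j - (j - (c - 2)) % d, ?_, ?_, (j - (c - 2)) / d, ?_⟩
    · have := Int.emod_nonneg (j - (c - 2)) hd0.ne'; lia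
    · have := Int.emod_lt_of_pos (j - (c - 2)) hd0; lia
    · have := Int.emod_add_mul_ediv (j - (c - 2)) d; lia
  obtain ⟨b, hb1, hb2, hb3⟩ : ∃ b, w ≤ b ∧ b < w + d ∧ d ∣ b - a := by
    refine ⟨w + (a - w) % d, ?_, ?_, -((a - w) / d), ?_⟩
    · have := Int.emod_nonneg (a - w) hd0.ne'; lia
    · have := Int.emod_lt_of_pos (a - w) hd0; lia
    · have := Int.emod_add_mul_ediv (a - w) d; lia
  set c' := w + 2 - e with hc'
  have hcc : d ∣ c' - c := by
    rw [show c' - c = (w - (c - 2)) - e by rw [hc']; ring]; exact dvd_sub hw3 hde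
  have hub : D.Adj u (x b) := (Pu hb3).2 ha
  have hbv : D.Adj (x b) v := (hsv.adj_iff b).2 fun h => ha' ((Pv (by simpa using hb3)).1 h)
  have hvc : D.Adj v (x c') := (Pv hcc).2 hc1
  have hcu : D.Adj (x (c' + e - 3)) u := (hsu.adj_iff _).2 fun h => hc2 ((Pu (by
    rw [show c' + e - 3 + 1 - (c - 2) = w - (c - 2) by rw [hc']; ring]; exact hw3)).1 h)
  have hbj : b ≠ j := by rintro rfl; exact huj hub
  have hl : D.IsLine x c' (c' + m - 1) := hc.isLine (by lia)
  have hnotdvd : ∀ k, c' ≤ k → k ≤ c' + m - 1 → k ≠ j → ¬ (m : ℤ) ∣ k - j := fun k h1 h2 h3 hdvd =>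
    h3 (hl.inj k j h1 h2 (by lia) (by lia) ((hc.eq_iff _ _).2 hdvd))
  have hvseg : v ∉ seg x c' (c' + e - 3) := fun h => by
    obtain ⟨k, h1, h2, h3⟩ := mem_seg.1 h
    exact hnotdvd k h1 (by lia) (by lia) (hv k h3)
  have hbseg : x b ∉ insert v (seg x c' (c' + e - 3)) := by
    rw [Finset.mem_insert, hl.mem_seg_iff le_rfl (by lia) (by lia) (by lia), not_or]
    exact ⟨fun h => hnotdvd b (by lia) (by lia) hbj (hv b h), by lia⟩
  have huseg : u ∉ insert (x b) (insert v (seg x c' (c' + e - 3))) := by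
    rw [Finset.mem_insert, Finset.mem_insert, not_or, not_or]
    refine ⟨fun h => hnotdvd b (by lia) (by lia) hbj (hu b h.symm), huv, fun h => ?_⟩
    obtain ⟨k, h1, h2, h3⟩ := mem_seg.1 h
    exact hnotdvd k h1 (by lia) (by lia) (hu k h3)
  have hcard : (insert u (insert (x b) (insert v (seg x c' (c' + e - 3))))).card = e + 1 := by
    rw [Finset.card_insert_of_notMem huseg, Finset.card_insert_of_notMem hbseg,
      Finset.card_insert_of_notMem hvseg, hl.card_seg le_rfl (by lia)]
    lia
  have := (PathOn.cons hub (.cons hbv (.cons hvc (hl.pathOn le_rfl (by lia) (by lia)) hvseg) hbseg)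
    huseg).hasCycle hcu (by lia)
  rw [hcard] at this
  exact hno this

variable [Fintype V]

/-- The hypotheses on a digraph `D` whose longest cycles have length `m ≥ 3`. -/
structure IsCritical (D : Digraph V) (m : ℕ) : Prop where
  loopless : D.Loopless
  deg : ∀ v, Fintype.card V ≤ D.degOn v Finset.univ + 1
  max : ∀ k, D.HasCycleOfLength k → k ≤ m
  three_le : 3 ≤ m

theorem not_enters_exits {m : ℕ} {x : ℤ → V} (hmax : ∀ k, D.HasCycleOfLength k → k ≤ m)
    (hc : D.IsCyc m x) {y : V} {i : ℤ} (hi : D.Enters x y i)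
    (hi' : D.Exits x y (i + 1)) : False := by
  obtain ⟨u, hu, hiu, huy⟩ := hi
  obtain ⟨v, hv, hyv, hvi⟩ := hi'
  obtain ⟨s, hs, hp⟩ := (huy.trans hyv).exists_pathOn hv
  have hl : D.IsLine x (i + 1) (i + m) := hc.isLine (by lia)
  have hm := hc.two_le
  have hd : Disjoint s (seg x (i + 1) (i + m)) := by
    rw [Finset.disjoint_left]
    intro z hz hz'
    obtain ⟨k, _, _, rfl⟩ := mem_seg.1 hz'
    exact hs hz ⟨k, rfl⟩
  have hcard := Finset.card_union_of_disjoint hd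
  have hpos := Finset.card_pos.2 ⟨_, hp.left_mem⟩
  rw [hl.card_seg le_rfl le_rfl] at hcard
  have := hmax _ ((hp.append hvi (hl.pathOn le_rfl (by lia) le_rfl) hd).hasCycle
    (by rwa [hc.add_period]) (by lia))
  lia

/-- If a vertex outside a longest cycle can replace the vertex of the cycle at the position `j`,
then these two vertices are twin blocks. -/
theorem IsCritical.twinBlocks {m : ℕ} (hD : D.IsCritical m) {x : ℤ → V} (hc : D.IsCyc m x) {y : V}
    (hy : y ∉ Set.range x) {j : ℤ} (h1 : D.Adj (x (j - 1)) y) (h2 : D.Adj y (x (j + 1))) :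
    D.TwinBlocks m x (j + 1) (j - 1 + m) {y} {x j} := by
  have hm := hD.three_le
  obtain ⟨T, hyT, hT, -, -, htw⟩ := exists_twinBlocks hD.loopless hD.deg hc hD.max hy (i := j - 1)
    (g := 2) (by lia) (by lia) ⟨y, hy, h1, .refl⟩
    ⟨y, hy, .refl, by rwa [show j - 1 + 2 = j + 1 by ring]⟩
    (fun i g' hg hg' h3 h4 => by
      obtain rfl : g' = 1 := by lia
      exact not_enters_exits hD.max hc h3 h4)
  obtain ⟨z, rfl⟩ := Finset.card_eq_one.1 (show T.card = 1 by lia)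
  rw [Finset.mem_singleton] at hyT
  subst hyT
  have : seg x (j - 1 + 1) (j - 1 + 2 - 1) = {x j} := by
    rw [show j - 1 + 1 = j by ring, show j - 1 + 2 - 1 = j by ring]; simp [seg]
  rw [this, show j - 1 + 2 = j + 1 by ring] at htw
  exact htw

theorem TwinBlocks.not_adj_singleton {m : ℕ} {x : ℤ → V} {a b : ℤ} {u v : V}
    (h : D.TwinBlocks m x a b {u} {v}) : ¬ D.Adj u v ∧ ¬ D.Adj v u :=
  h.not_adj u (by simp) v (by simp)

theorem TwinBlocks.splits {m : ℕ} {x : ℤ → V} {j : ℤ} (hc : D.IsCyc m x) {y : V}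
    (h : D.TwinBlocks m x (j + 1) (j - 1 + m) {y} {x j}) : D.Splits x y := by
  intro i
  obtain ⟨k, hk1, hk2, hk3, hk4⟩ := hc.exists_rep i (j + 1)
  have hk5 : x (k + 1) = x (i + 1) := (hc.eq_iff _ _).2 (by simpa using hk4)
  rw [← hk3, ← hk5]
  have hy : y ∈ ({y} ∪ {x j} : Finset V) := by simp
  obtain ⟨h1, h2⟩ := h.not_adj_singleton
  by_cases hk6 : k < j - 1 + m
  · exact h.xor y hy k hk1 hk6
  by_cases hk7 : k = j - 1 + m
  · subst hk7
    refine .inl ⟨h.from_last y hy, ?_⟩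
    rwa [show j - 1 + m + 1 = j + m by ring, hc.add_period]
  · obtain rfl : k = j + m := by lia
    refine .inr ⟨?_, by rwa [hc.add_period]⟩
    rw [show j + m + 1 = j + 1 + m by ring, hc.add_period]
    exact h.to_first y hy

/-- A vertex outside a longest cycle that splits it. -/
structure IsHub (D : Digraph V) (m : ℕ) (x : ℤ → V) (y : V) : Prop where
  cyc : D.IsCyc m x
  notMem : y ∉ Set.range x
  splits : D.Splits x y

theorem IsHub.twinBlocks {m : ℕ} (hD : D.IsCritical m) {x : ℤ → V} {y : V} (h : D.IsHub m x y)
    {j : ℤ} (h1 : ¬ D.Adj y (x j)) (h2 : D.Adj y (x (j + 1))) :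
    D.TwinBlocks m x (j + 1) (j - 1 + m) {y} {x j} :=
  hD.twinBlocks h.cyc h.notMem ((h.splits.adj_iff _).2 (by rwa [sub_add_cancel])) h2

/-- Exchanging the hub with a vertex of the cycle that it can replace gives a hub again. -/
theorem IsHub.exchange {m : ℕ} (hD : D.IsCritical m) {x : ℤ → V} {y : V} (h : D.IsHub m x y)
    {j : ℤ} (h1 : ¬ D.Adj y (x j)) (h2 : D.Adj y (x (j + 1))) :
    D.IsHub m (fun i => if (m : ℤ) ∣ i - j then y else x i) (x j) ∧ D.Splits x (x j) ∧
      ∀ i, D.Adj (x j) (if (m : ℤ) ∣ i - j then y else x i) ↔ D.Adj (x j) (x i) := by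
  have htw := h.twinBlocks hD h1 h2
  have hc := h.cyc
  have h0 : D.Adj (x (j - 1)) y := (h.splits.adj_iff _).2 (by rwa [sub_add_cancel])
  have hc' := hc.replace h.notMem h0 h2
  set x' : ℤ → V := fun i => if (m : ℤ) ∣ i - j then y else x i with hx'
  have hm := hD.three_le
  have hnd : ∀ k : ℤ, k ≠ 0 → -2 < k → k < 2 → ¬ (m : ℤ) ∣ j + k - j := fun k h1 h2 h3 hd => by
    rw [add_sub_cancel_left] at hd
    exact h1 (Int.eq_zero_of_abs_lt_dvd hd (by rw [abs_lt]; constructor <;> lia))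
  have e1 : x' (j - 1) = x (j - 1) := if_neg (hnd (-1) (by lia) (by lia) (by lia))
  have e2 : x' (j + 1) = x (j + 1) := if_neg (hnd 1 (by lia) (by lia) (by lia))
  have hnot : x j ∉ Set.range x' := by
    rintro ⟨i, hi⟩
    simp only [hx'] at hi
    split at hi
    · exact h.notMem ⟨j, hi.symm⟩
    · rename_i hd
      exact hd ((hc.eq_iff _ _).1 hi)
  have htw' := hD.twinBlocks (j := j) hc' hnot (by rw [e1]; simpa using hc.adj (j - 1))
    (by rw [e2]; exact hc.adj j)
  obtain ⟨n1, n2⟩ := htw.not_adj_singleton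
  have hl := hD.loopless (x j)
  have hout : ∀ i, D.Adj (x j) (x' i) ↔ D.Adj (x j) (x i) := fun i => by
    by_cases hd : (m : ℤ) ∣ i - j
    · simp only [hx', hd, if_true, (hc.eq_iff i j).2 hd, n2, hl]
    · simp only [hx', hd, if_false]
  have hin : ∀ i, D.Adj (x' i) (x j) ↔ D.Adj (x i) (x j) := fun i => by
    by_cases hd : (m : ℤ) ∣ i - j
    · simp only [hx', hd, if_true, (hc.eq_iff i j).2 hd, n1, hl]
    · simp only [hx', hd, if_false]
  have hs := htw'.splits hc'
  exact ⟨⟨hc', hnot, hs⟩, fun i => by have := hs i; rwa [hout, hin] at this, hout⟩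

/-- The comparison of the out-neighbourhoods of two vertices that can replace each other. -/
theorem IsHub.compare {m : ℕ} (hD : D.IsCritical m) {x : ℤ → V} {y : V} (h : D.IsHub m x y)
    {j : ℤ} (h1 : ¬ D.Adj y (x j)) (h2 : D.Adj y (x (j + 1))) {e : ℕ} (he : 1 ≤ e) (hem : e < m)
    (hno : ¬ D.HasCycleOfLength (e + 1)) :
    (∀ i, D.Adj (x j) (x i) → D.Adj (x j) (x (i + e))) ∧ (3 ≤ e →
      ((∀ a, D.Adj y (x a) → D.Adj (x j) (x (a + 1))) ∨
        (∀ c, D.Adj (x j) (x c) → D.Adj y (x (c - 2)))) ∧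
      ((∀ a, D.Adj (x j) (x a) → D.Adj y (x (a + 1))) ∨
        (∀ c, D.Adj y (x c) → D.Adj (x j) (x (c - 2))))) := by
  obtain ⟨hub', hs, hout⟩ := h.exchange hD h1 h2
  have hsh := h.splits.shift h.cyc h.notMem he hem hno
  have hsh' : ∀ i, D.Adj (x j) (x i) → D.Adj (x j) (x (i + e)) := fun i => by
    have := hub'.splits.shift hub'.cyc hub'.notMem he hem hno i
    rwa [hout, hout] at this
  have hu : ∀ i, x i = y → (m : ℤ) ∣ i - j := fun i hi => absurd ⟨i, hi⟩ h.notMem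
  have hv : ∀ i, x i = x j → (m : ℤ) ∣ i - j := fun i hi => (h.cyc.eq_iff _ _).1 hi
  have huv : y ≠ x j := fun hy => h.notMem ⟨j, hy.symm⟩
  exact ⟨hsh', fun he3 => ⟨shift_or_shift h.cyc he3 hem hno hu hv huv h.splits hs hsh hsh' h1,
    shift_or_shift h.cyc he3 hem hno hv hu huv.symm hs h.splits hsh' hsh
      (hD.loopless _)⟩⟩

/-- If the out-neighbourhoods of the two vertices agree at the position `j + 2`, then the first one
consists of every second vertex of the cycle. -/
theorem IsHub.adj_iff_even {m : ℕ} (hD : D.IsCritical m) {x : ℤ → V} {y : V} (h : D.IsHub m x y)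
    {j : ℤ} (h1 : ¬ D.Adj y (x j)) (h2 : D.Adj y (x (j + 1))) {e : ℕ} (he : 3 ≤ e) (hem : e < m)
    (hno : ¬ D.HasCycleOfLength (e + 1))
    (hbit : D.Adj y (x (j + 2)) ↔ D.Adj (x j) (x (j + 2))) (i : ℤ) :
    D.Adj y (x i) ↔ Even (i - (j + 1)) := by
  have hm : 0 < m := by lia
  have hper : ∀ i, D.Adj y (x (i + m)) ↔ D.Adj y (x i) := fun i => by rw [h.cyc.add_period]
  obtain ⟨hA, hB⟩ := (h.compare hD h1 h2 (by lia) hem hno).2 he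
  have hvj : ¬ D.Adj (x j) (x j) := hD.loopless _
  have hv1 : D.Adj (x j) (x (j + 1)) := h.cyc.adj j
  have e1 : j + 1 + 1 = j + 2 := by ring
  have e2 : j + 2 - 2 = j := by ring
  rcases hA with hA | hA <;> rcases hB with hB | hB
  · -- the out-neighbourhood of `y` is invariant under the shift by `2`
    have hP := fun {i k : ℤ} (hik : (Int.gcd 2 m : ℤ) ∣ i - k) =>
      iff_of_gcd_dvd (P := fun i => D.Adj y (x i)) hm hper (e := 2)
        (fun i hi => by have := hB _ (hA i hi); rwa [add_assoc] at this) hik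
    have hd : (Int.gcd 2 m : ℤ) ∣ 2 := Int.gcd_dvd_left ..
    by_cases hi : Even (i - (j + 1))
    · simp only [hi, iff_true]
      exact (hP (hd.trans hi.two_dvd)).2 h2
    · simp only [hi, iff_false]
      refine fun hcon => h1 ((hP (hd.trans (Even.two_dvd ?_))).1 hcon)
      rw [Int.even_sub] at hi ⊢
      rw [Int.even_add_one] at hi
      tauto
  · have := hA _ h2
    rw [e1] at this
    have := hB _ (hbit.2 this)
    rw [e2] at this
    exact absurd this hvj
  · have := hB _ hv1
    rw [e1] at this
    have := hA _ (hbit.1 this)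
    rw [e2] at this
    exact absurd this h1
  · -- now it is invariant under the shift by `-4`
    have hP := fun {i k : ℤ} (hik : (Int.gcd (-4) m : ℤ) ∣ i - k) =>
      iff_of_gcd_dvd (P := fun i => D.Adj y (x i)) hm hper (e := -4)
        (fun i hi => by
          have := hA _ (hB i hi)
          rwa [show i - 2 - 2 = i + -4 by ring] at this) hik
    have hd : (Int.gcd (-4) m : ℤ) ∣ 4 := by
      have : (Int.gcd (-4) m : ℤ) ∣ -4 := Int.gcd_dvd_left ..
      rwa [dvd_neg] at this
    have h3 : ¬ D.Adj y (x (j + 2)) := fun hcon => by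
      have := hB _ hcon
      rw [e2] at this
      exact hvj this
    have h4 : D.Adj y (x (j - 1)) := by
      have := hA _ hv1
      rwa [show j + 1 - 2 = j - 1 by ring] at this
    by_cases hi : Even (i - (j + 1))
    · simp only [hi, iff_true]
      obtain ⟨k, hk⟩ := hi
      rcases Int.even_or_odd k with ⟨l, hl⟩ | ⟨l, hl⟩
      · exact (hP (hd.trans ⟨l, by lia⟩)).2 h2
      · exact (hP (hd.trans ⟨l + 1, by lia⟩)).2 h4
    · simp only [hi, iff_false]
      intro hcon
      rw [Int.not_even_iff_odd] at hi
      obtain ⟨k, hk⟩ := hi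
      rcases Int.even_or_odd k with ⟨l, hl⟩ | ⟨l, hl⟩
      · exact h3 ((hP (hd.trans ⟨l, by lia⟩)).1 hcon)
      · exact h1 ((hP (hd.trans ⟨l + 1, by lia⟩)).1 hcon)

/-- If there is no cycle of length `e + 1`, then some hub dominates exactly every second vertex of
its cycle. Among the three vertices `y`, `x (-1)` and `x (e - 1)`, any two of which can replace
each other, two agree at the position `1`. -/
theorem IsHub.exists_even {m : ℕ} (hD : D.IsCritical m) {x : ℤ → V} {y : V} (h : D.IsHub m x y)
    (h1 : ¬ D.Adj y (x (-1))) (h2 : D.Adj y (x 0)) {e : ℕ} (he : 1 ≤ e) (hem : e < m)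
    (hno : ¬ D.HasCycleOfLength (e + 1)) :
    2 ≤ e ∧ ∃ x' y', D.IsHub m x' y' ∧ ∀ i, D.Adj y' (x' i) ↔ Even i := by
  have hm := hD.three_le
  have hper : ∀ i, D.Adj y (x (i + m)) ↔ D.Adj y (x i) := fun i => by rw [h.cyc.add_period]
  have hsh := h.splits.shift h.cyc h.notMem he hem hno
  have hP := fun {i k : ℤ} (hik : (Int.gcd e m : ℤ) ∣ i - k) =>
    iff_of_gcd_dvd (P := fun i => D.Adj y (x i)) (by lia) hper hsh hik
  have hde : (Int.gcd e m : ℤ) ∣ e := Int.gcd_dvd_left ..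
  have he2 : 2 ≤ e := by
    by_contra hcon
    obtain rfl : e = 1 := by lia
    exact h1 ((hP (hde.trans ⟨-1, by lia⟩)).2 h2)
  refine ⟨he2, ?_⟩
  rcases eq_or_lt_of_le he2 with rfl | he3
  · refine ⟨x, y, h, fun i => ?_⟩
    by_cases hi : Even i
    · simp only [hi, iff_true]
      exact (hP (hde.trans (by simpa using hi.two_dvd))).2 h2
    · simp only [hi, iff_false]
      rw [Int.not_even_iff_odd] at hi
      obtain ⟨k, hk⟩ := hi
      exact fun hcon => h1 ((hP (hde.trans ⟨k + 1, by push_cast; lia⟩)).1 hcon)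
  -- a hub whose out-neighbourhood alternates, up to a shift of the indices
  suffices hex : ∃ x' y' c, D.IsHub m x' y' ∧ ∀ i, D.Adj y' (x' i) ↔ Even (i - c) by
    obtain ⟨x', y', c, hh, hev⟩ := hex
    refine ⟨fun i => x' (i + c), y', ⟨hh.cyc.shift c, ?_, ?_⟩, fun i => ?_⟩
    · rintro ⟨i, hi⟩; exact hh.notMem ⟨_, hi⟩
    · intro i
      have := hh.splits (i + c)
      rwa [add_right_comm] at this
    · rw [hev]; simp
  have g1 : ¬ D.Adj y (x (e - 1)) := fun hcon => h1 ((hP (hde.trans ⟨-1, by lia⟩)).2 hcon)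
  have g2 : D.Adj y (x (e - 1 + 1)) := (hP (hde.trans ⟨1, by lia⟩)).2 h2
  have h2' : D.Adj y (x (-1 + 1)) := h2
  have hbit : D.Adj y (x (e - 1 + 2)) ↔ D.Adj y (x (-1 + 2)) := hP (hde.trans ⟨1, by lia⟩)
  obtain ⟨hub', -, hout⟩ := h.exchange hD h1 h2'
  obtain ⟨hsh1, -⟩ := h.compare hD h1 h2' he hem hno
  obtain ⟨hsh2, -⟩ := h.compare hD g1 g2 he hem hno
  have hP1 := fun {i k : ℤ} (hik : (Int.gcd e m : ℤ) ∣ i - k) =>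
    iff_of_gcd_dvd (P := fun i => D.Adj (x (-1)) (x i)) (by lia)
      (fun i => by rw [h.cyc.add_period]) hsh1 hik
  have f1 : ¬ D.Adj (x (-1)) (x (e - 1)) := fun hcon =>
    hD.loopless _ ((hP1 (hde.trans ⟨-1, by lia⟩)).2 hcon)
  have f2 : D.Adj (x (-1)) (x (e - 1 + 1)) := (hP1 (hde.trans ⟨1, by lia⟩)).2 (h.cyc.adj (-1))
  have hbit1 : D.Adj (x (-1)) (x (e - 1 + 2)) ↔ D.Adj (x (-1)) (x (-1 + 2)) :=
    hP1 (hde.trans ⟨1, by lia⟩)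
  have hej : ¬ (m : ℤ) ∣ e - 1 - -1 := fun hd => by
    have := Int.le_of_dvd (by lia) hd
    lia
  by_cases b1 : D.Adj y (x (-1 + 2)) ↔ D.Adj (x (-1)) (x (-1 + 2))
  · exact ⟨x, y, _, h, h.adj_iff_even hD h1 h2' he3 hem hno b1⟩
  by_cases b2 : D.Adj y (x (e - 1 + 2)) ↔ D.Adj (x (e - 1)) (x (e - 1 + 2))
  · exact ⟨x, y, _, h, h.adj_iff_even hD g1 g2 he3 hem hno b2⟩
  refine ⟨_, x (-1), _, hub', hub'.adj_iff_even hD (j := e - 1) ?_ ?_ he3 hem hno ?_⟩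
  · rwa [hout]
  · rwa [hout]
  · rw [hout, if_neg hej]
    have hnd : ¬ (m : ℤ) ∣ e - 1 + 2 - -1 := fun hd => by
      -- otherwise the position `e + 1` is the position `-1`, where both adjacencies fail
      have heq : x (e - 1 + 2) = x (-1) := (h.cyc.eq_iff _ _).2 hd
      have hP2 := fun {i k : ℤ} (hik : (Int.gcd e m : ℤ) ∣ i - k) =>
        iff_of_gcd_dvd (P := fun i => D.Adj (x (e - 1)) (x i)) (by lia)
          (fun i => by rw [h.cyc.add_period]) hsh2 hik
      have k1 : ¬ D.Adj y (x (e - 1 + 2)) := by rwa [heq]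
      have k2 : ¬ D.Adj (x (e - 1)) (x (e - 1 + 2)) := by
        rw [heq]
        exact fun hcon => hD.loopless _ ((hP2 (hde.trans ⟨1, by lia⟩)).2 hcon)
      exact b2 ⟨fun h => absurd h k1, fun h => absurd h k2⟩
    rw [if_neg hnd]
    tauto

/-- If a hub dominates exactly the vertices at even positions, then each vertex at an odd position
has the same in- and out-neighbours on the cycle as the hub. -/
theorem IsHub.odd_adj_iff {m : ℕ} (hD : D.IsCritical m) {x : ℤ → V} {y : V} (h : D.IsHub m x y)
    (hev : ∀ i, D.Adj y (x i) ↔ Even i) {e : ℕ} (he : 2 ≤ e) (hem : e < m)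
    (hno : ¬ D.HasCycleOfLength (e + 1)) {j : ℤ} (hj : Odd j) :
    (∀ i, D.Adj (x j) (x i) ↔ Even i) ∧ ∀ i, D.Adj (x i) (x j) ↔ Even i := by
  have h1 : ¬ D.Adj y (x j) := by rw [hev]; exact Int.not_even_iff_odd.2 hj
  have h2 : D.Adj y (x (j + 1)) := by rw [hev]; exact hj.add_one
  obtain ⟨-, hs, -⟩ := h.exchange hD h1 h2
  obtain ⟨hsh, hcmp⟩ := h.compare hD h1 h2 (by lia) hem hno
  have hv1 : D.Adj (x j) (x (j + 1)) := h.cyc.adj j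
  have key : ∀ i, D.Adj (x j) (x i) ↔ Even i := by
    rcases eq_or_lt_of_le he with rfl | he3
    · intro i
      have hP := fun {i k : ℤ} (hik : (Int.gcd (2 : ℕ) m : ℤ) ∣ i - k) =>
        iff_of_gcd_dvd (P := fun i => D.Adj (x j) (x i)) (by lia)
          (fun i => by rw [h.cyc.add_period]) hsh hik
      have hde : (Int.gcd (2 : ℕ) m : ℤ) ∣ (2 : ℕ) := Int.gcd_dvd_left ..
      by_cases hi : Even i
      · simp only [hi, iff_true]
        exact (hP (hde.trans (hi.sub hj.add_one).two_dvd)).2 hv1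
      · simp only [hi, iff_false]
        rw [Int.not_even_iff_odd] at hi
        exact fun hcon => hD.loopless _ ((hP (hde.trans (hi.sub_odd hj).two_dvd)).1 hcon)
    · obtain ⟨hA, hB⟩ := hcmp he3
      have hA' : ∀ c, D.Adj (x j) (x c) → D.Adj y (x (c - 2)) := hA.resolve_left fun hA => by
        have := hA (j - 1) (by rw [hev]; exact hj.sub_odd odd_one)
        rw [sub_add_cancel] at this
        exact hD.loopless _ this
      have hB' : ∀ c, D.Adj y (x c) → D.Adj (x j) (x (c - 2)) := hB.resolve_left fun hB => by
        have := hB (j + 1) hv1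
        rw [hev, Int.even_add_one, Int.even_add_one, not_not] at this
        exact Int.not_even_iff_odd.2 hj this
      intro i
      constructor
      · intro hi
        have := hA' i hi
        rw [hev] at this
        simpa using this.add even_two
      · intro hi
        have := hB' (i + 2) (by rw [hev]; exact hi.add even_two)
        rwa [add_sub_cancel_right] at this
  refine ⟨key, fun i => ?_⟩
  rw [hs.adj_iff, key, Int.even_add_one, not_not]

end Hubs

end Digraph

/-! ### The complete bipartite case -/

namespace Digraph

section Bipartite

variable {V : Type*} [DecidableEq V] {D : Digraph V} [Fintype V]

/-- An arc between two vertices at even positions would give a cycle of the missing length, which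
is odd: follow the cycle and use that the vertices at odd positions, as well as the hub, are joined
in both directions to all vertices at even positions. -/
theorem IsHub.not_adj_of_even {m : ℕ} (hD : D.IsCritical m) {x : ℤ → V} {y : V}
    (h : D.IsHub m x y) (hev : ∀ i, D.Adj y (x i) ↔ Even i) {e : ℕ} (he : 2 ≤ e) (hem : e < m)
    (hno : ¬ D.HasCycleOfLength (e + 1)) {a b : ℤ} (ha : Even a) (hb : Even b) :
    ¬ D.Adj (x a) (x b) := by
  intro hab
  have hodd := fun {j : ℤ} (hj : Odd j) => h.odd_adj_iff hD hev he hem hno hj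
  have hyin : ∀ {i : ℤ}, Even i → D.Adj (x i) y := fun {i} hi => by
    rw [h.splits.adj_iff, hev, Int.even_add_one, not_not]; exact hi
  have hc := h.cyc
  have hme : Even (m : ℤ) := by
    have h0 := (hev 0).2 Even.zero
    rw [← hc.add_period, hev] at h0
    simpa using h0
  have hee : Even (e : ℤ) := by
    have h0 := h.splits.shift hc h.notMem (by lia) hem hno 0 ((hev 0).2 Even.zero)
    rw [hev] at h0
    simpa using h0
  -- take the index of the first vertex within one turn after `b`
  obtain ⟨a', h1, h2, h3, h4⟩ := hc.exists_rep a b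
  have ha' : Even a' := by
    have := (hme.two_dvd.trans h4)
    rw [← even_iff_two_dvd] at this
    simpa using this.add ha
  rw [← h3] at hab
  have hne : a' ≠ b := by rintro rfl; exact hD.loopless _ hab
  obtain ⟨α, hα⟩ := ha'
  obtain ⟨β, hβ⟩ := hb
  obtain ⟨μ, hμ⟩ := hme
  obtain ⟨ε, hε⟩ := hee
  have hl : D.IsLine x b (b + m - 1) := hc.isLine (by lia)
  have hyseg : ∀ i j, y ∉ seg x i j := fun i j hm => by
    obtain ⟨k, _, _, hk⟩ := mem_seg.1 hm
    exact h.notMem ⟨k, hk⟩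
  by_cases hcase : b + e - 2 < a'
  · have n1 : x a' ∉ seg x b (b + e - 2) := by
      rw [hl.mem_seg_iff le_rfl (by lia) (by lia) (by lia)]; lia
    have n2 : y ∉ insert (x a') (seg x b (b + e - 2)) := by
      rw [Finset.mem_insert, not_or]
      exact ⟨fun hy => h.notMem ⟨a', hy.symm⟩, hyseg _ _⟩
    have hcard : (insert y (insert (x a') (seg x b (b + e - 2)))).card = e + 1 := by
      rw [Finset.card_insert_of_notMem n2, Finset.card_insert_of_notMem n1,
        hl.card_seg le_rfl (by lia)]
      lia
    have := (PathOn.cons ((hev a').2 ⟨α, hα⟩) (.cons hab (hl.pathOn le_rfl (by lia) (by lia)) n1)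
      n2).hasCycle (hyin ⟨β + ε - 1, by lia⟩) (by lia)
    rw [hcard] at this
    exact hno this
  · have n1 : x a' ∉ seg x b (a' - 1) := by
      rw [hl.mem_seg_iff le_rfl (by lia) (by lia) (by lia)]; lia
    have d : Disjoint (insert (x a') (seg x b (a' - 1))) (seg x (a' + 2) (b + e + 1)) := by
      rw [Finset.disjoint_insert_left]
      refine ⟨?_, hl.seg_disjoint le_rfl (by lia) (by lia)⟩
      rw [hl.mem_seg_iff (by lia) (by lia) (by lia) (by lia)]; lia
    have hcard : (insert (x a') (seg x b (a' - 1)) ∪ seg x (a' + 2) (b + e + 1)).card = e + 1 := by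
      rw [Finset.card_union_of_disjoint d, Finset.card_insert_of_notMem n1,
        hl.card_seg le_rfl (by lia), hl.card_seg (by lia) (by lia)]
      lia
    have o1 : Odd (a' - 1) := ⟨α - 1, by lia⟩
    have o2 : Odd (b + e + 1) := ⟨β + ε, by lia⟩
    have := ((PathOn.cons hab (hl.pathOn le_rfl (by lia) (by lia)) n1).append
      (((hodd o1).1 _).2 ⟨α + 1, by lia⟩) (hl.pathOn (by lia) (by lia) (by lia)) d).hasCycle
      (((hodd o2).1 _).2 ⟨α, hα⟩) (by lia)
    rw [hcard] at this
    exact hno this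

/-- The hub is the only vertex outside the cycle: the hub and the vertices at odd positions can
replace each other, so a walk that leaves one of them for another vertex outside the cycle cannot
come back to any of them, and if it comes back to a vertex at an even position, it gives a cycle
that is too long. -/
theorem IsHub.eq_of_notMem {m : ℕ} (hD : D.IsCritical m) (hstrong : D.StronglyConnected)
    {x : ℤ → V} {y : V} (h : D.IsHub m x y) (hev : ∀ i, D.Adj y (x i) ↔ Even i) {z : V}
    (hz : z ∉ Set.range x) : z = y := by
  by_contra hzy
  have hc := h.cyc
  have hm := hD.three_le
  have htw : ∀ {j : ℤ}, Odd j → D.TwinBlocks m x (j + 1) (j - 1 + m) {y} {x j} := fun {j} hj =>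
    h.twinBlocks hD (by rw [hev]; exact Int.not_even_iff_odd.2 hj) (by rw [hev]; exact hj.add_one)
  have hyin : ∀ {i : ℤ}, Even i → D.Adj (x i) y := fun {i} hi => by
    rw [h.splits.adj_iff, hev, Int.even_add_one, not_not]; exact hi
  set U : Set V := insert y (Set.range x) with hU
  have hUeq : ∀ j, (↑({y} ∪ {x j} ∪ seg x (j + 1) (j - 1 + m) : Finset V) : Set V) = U := by
    intro j
    rw [hU, ← hc.seg_eq_range j]
    ext v
    simp only [Finset.coe_union, Finset.coe_singleton, Set.mem_union, Set.mem_singleton_iff,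
      Finset.mem_coe, Set.mem_insert_iff, mem_seg, or_assoc]
    refine or_congr Iff.rfl ⟨?_, ?_⟩
    · rintro (rfl | ⟨k, h1, h2, rfl⟩)
      · exact ⟨j, by lia, by lia, rfl⟩
      · exact ⟨k, by lia, by lia, rfl⟩
    · rintro ⟨k, h1, h2, rfl⟩
      rcases eq_or_lt_of_le h1 with rfl | h1
      · exact .inl rfl
      · exact .inr ⟨k, by lia, by lia, rfl⟩
  have hnotU : ∀ j v, v ∉ ({y} ∪ {x j} ∪ seg x (j + 1) (j - 1 + m) : Finset V) ↔ v ∉ U :=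
    fun j v => by rw [← hUeq j, Finset.mem_coe]
  have hzU : z ∉ U := by simp only [hU, Set.mem_insert_iff, not_or]; exact ⟨hzy, hz⟩
  have nor : ∀ {j}, Odd j → ∀ w w', w ∉ U → D.WalkIn Uᶜ w w' → ∀ u u', (u = y ∨ u = x j) →
      (u' = y ∨ u' = x j) → D.Adj u w → ¬ D.Adj w' u' := by
    intro j hj w w' hw hww' u u' hu hu'
    refine (htw hj).no_return w w' ((hnotU j w).2 hw) (by rwa [hUeq]) u ?_ u' ?_ <;>
      simpa using ‹_›
  have dich : ∀ {j}, Odd j → (D.Adj y z ∧ D.Adj (x j) z) ∨ (D.Adj z y ∧ D.Adj z (x j)) := by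
    intro j hj
    have hy : y ∈ ({y} ∪ {x j} : Finset V) := by simp
    have hx : x j ∈ ({y} ∪ {x j} : Finset V) := by simp
    rcases (htw hj).outside z ((hnotU j z).2 hzU) with ho | ho
    · exact .inl ⟨(ho y hy).1, (ho _ hx).1⟩
    · exact .inr ⟨(ho y hy).1, (ho _ hx).1⟩
  -- a walk outside from `y` back to the cycle and one from the cycle to `y`, over `z`
  have long : ∀ i k w w', w ∉ U → D.WalkIn Uᶜ w w' → (m : ℤ) ∣ k + 2 - i → D.Adj w' (x i) →
      D.Adj (x k) y → ¬ D.Adj y w := by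
    intro i k w w' hw hww' hik hwi hky hyw
    obtain ⟨s, hs, hp⟩ := hww'.exists_pathOn (hww'.mem hw)
    have hl : D.IsLine x (k + 2) (k + m) := hc.isLine (by lia)
    rw [← (hc.eq_iff _ _).2 hik] at hwi
    have hys : y ∉ s := fun hm => hs hm (Set.mem_insert _ _)
    have d : Disjoint (insert y s) (seg x (k + 2) (k + m)) := by
      rw [Finset.disjoint_right]
      intro v hv hv'
      obtain ⟨l, _, _, rfl⟩ := mem_seg.1 hv
      rcases Finset.mem_insert.1 hv' with hv' | hv'
      · exact h.notMem ⟨l, hv'⟩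
      · exact hs hv' (Set.mem_insert_of_mem _ ⟨l, rfl⟩)
    have hcard : (insert y s ∪ seg x (k + 2) (k + m)).card = m + s.card := by
      rw [Finset.card_union_of_disjoint d, Finset.card_insert_of_notMem hys,
        hl.card_seg le_rfl le_rfl]
      lia
    have hpos := Finset.card_pos.2 ⟨_, hp.left_mem⟩
    have := hD.max _ (((PathOn.cons hyw hp hys).append hwi
      (hl.pathOn le_rfl (by lia) le_rfl) d).hasCycle (by rwa [hc.add_period]) (by lia))
    lia
  have long' : ∀ i k w w', w ∉ U → D.WalkIn Uᶜ w w' → (m : ℤ) ∣ i + 2 - k → D.Adj (x i) w →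
      D.Adj y (x k) → ¬ D.Adj w' y := by
    intro i k w w' hw hww' hik hwi hky hyw
    obtain ⟨s, hs, hp⟩ := hww'.exists_pathOn (hww'.mem hw)
    have hl : D.IsLine x (i + 2) (i + m) := hc.isLine (by lia)
    rw [← (hc.eq_iff _ _).2 hik] at hky
    have d0 : Disjoint s {y} := by
      rw [Finset.disjoint_singleton_right]
      exact fun hm => hs hm (Set.mem_insert _ _)
    have d : Disjoint (s ∪ {y}) (seg x (i + 2) (i + m)) := by
      rw [Finset.disjoint_right]
      intro v hv hv'
      obtain ⟨l, _, _, rfl⟩ := mem_seg.1 hv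
      rcases Finset.mem_union.1 hv' with hv' | hv'
      · exact hs hv' (Set.mem_insert_of_mem _ ⟨l, rfl⟩)
      · exact h.notMem ⟨l, by simpa using hv'⟩
    have hcard : (s ∪ {y} ∪ seg x (i + 2) (i + m)).card = m + s.card := by
      rw [Finset.card_union_of_disjoint d, Finset.card_union_of_disjoint d0,
        hl.card_seg le_rfl le_rfl, Finset.card_singleton]
      lia
    have hpos := Finset.card_pos.2 ⟨_, hp.left_mem⟩
    have := hD.max _ (((hp.append hyw (.single y) d0).append hky
      (hl.pathOn le_rfl (by lia) le_rfl) d).hasCycle (by rwa [hc.add_period]) (by lia))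
    lia
  have hyU : y ∈ U := Set.mem_insert _ _
  rcases dich odd_one with ⟨hyz, -⟩ | ⟨hzy', -⟩
  · obtain ⟨w, u, hw, hu, hwu, hzw⟩ := exists_first_entry (P := (· ∈ U)) (hstrong z y hzy) hzU hyU
    rcases Set.mem_insert_iff.1 hu with rfl | ⟨i, rfl⟩
    · exact nor odd_one z w hzU hzw u u (.inl rfl) (.inl rfl) hyz hwu
    · rcases Int.even_or_odd i with hi | hi
      · exact long i (i - 2) z w hzU hzw (by simp) hwu (hyin (hi.sub even_two)) hyz
      · exact nor hi z w hzU hzw y (x i) (.inl rfl) (.inr rfl) hyz hwu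
  · obtain ⟨u, w, hu, hw, huw, hwz⟩ := exists_last_exit (P := (· ∈ U)) (hstrong y z (Ne.symm hzy))
      hyU hzU
    rcases Set.mem_insert_iff.1 hu with rfl | ⟨i, rfl⟩
    · exact nor odd_one w z hw hwz u u (.inl rfl) (.inl rfl) huw hzy'
    · rcases Int.even_or_odd i with hi | hi
      · exact long' i (i + 2) w z hw hwz (by simp) huw ((hev _).2 (hi.add even_two)) hzy'
      · exact nor hi w z hw hwz (x i) y (.inr rfl) (.inl rfl) huw hzy'

theorem IsHub.isomorphic {m : ℕ} (hD : D.IsCritical m) (hstrong : D.StronglyConnected)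
    {x : ℤ → V} {y : V} (h : D.IsHub m x y) (hev : ∀ i, D.Adj y (x i) ↔ Even i) {e : ℕ}
    (he : 2 ≤ e) (hem : e < m) (hno : ¬ D.HasCycleOfLength (e + 1)) :
    Odd (Fintype.card V) ∧ D.Isomorphic (Digraph.completeBipartiteGraph
      (Fin (Fintype.card V / 2)) (Fin (Fintype.card V / 2 + 1))) := by
  have hc := h.cyc
  have hm := hD.three_le
  have hyin : ∀ i : ℤ, D.Adj (x i) y ↔ Even i := fun i => by
    rw [h.splits.adj_iff, hev, Int.even_add_one, not_not]
  have hodd := fun {j : ℤ} (hj : Odd j) => h.odd_adj_iff hD hev he hem hno hj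
  obtain ⟨n, hn⟩ : Even m := by
    have h0 := (hev 0).2 Even.zero
    rw [← hc.add_period, hev, zero_add] at h0
    exact_mod_cast h0
  have hl : D.IsLine x 0 (0 + m - 1) := hc.isLine (by lia)
  have hcardV : Fintype.card V = 2 * n + 1 := by
    have hy : y ∉ seg x 0 (0 + m - 1) := fun hy => h.notMem ((hc.mem_seg_iff_range 0).1 hy)
    have huniv : (Finset.univ : Finset V) = insert y (seg x 0 (0 + m - 1)) := by
      ext v
      simp only [Finset.mem_univ, true_iff, Finset.mem_insert]
      by_cases hv : v ∈ Set.range x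
      · exact .inr ((hc.mem_seg_iff_range 0).2 hv)
      · exact .inl (h.eq_of_notMem hD hstrong hev hv)
    rw [← Finset.card_univ, huniv, Finset.card_insert_of_notMem hy, hl.card_seg le_rfl le_rfl]
    lia
  have hhalf : Fintype.card V / 2 = n := by lia
  refine ⟨⟨n, hcardV⟩, ?_⟩
  rw [hhalf]
  -- the small side consists of the even positions, the large one of the odd positions and the hub
  let f : Fin n ⊕ Fin (n + 1) → V :=
    Sum.elim (fun k => x (2 * (k : ℤ))) fun k => if (k : ℕ) < n then x (2 * (k : ℤ) + 1) else y
  have hne : ∀ i, x i ≠ y := fun i hi => h.notMem ⟨i, hi⟩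
  have hinj : Function.Injective f := by
    have hxi : ∀ i j : ℤ, 0 ≤ i → i < m → 0 ≤ j → j < m → x i = x j → i = j :=
      fun i j h1 h2 h3 h4 => hl.inj i j h1 (by lia) h3 (by lia)
    rintro (k | k) (l | l) hkl <;> have hk' := k.2 <;> have hl' := l.2 <;>
      simp only [f, Sum.elim_inl, Sum.elim_inr] at hkl
    · have := hxi _ _ (by omega) (by omega) (by omega) (by omega) hkl
      rw [Sum.inl.injEq, Fin.ext_iff]; lia
    · split at hkl
      · have := hxi _ _ (by omega) (by omega) (by omega) (by omega) hkl
        lia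
      · exact absurd hkl (hne _)
    · split at hkl
      · have := hxi _ _ (by omega) (by omega) (by omega) (by omega) hkl
        lia
      · exact absurd hkl.symm (hne _)
    · rw [Sum.inr.injEq, Fin.ext_iff]
      split at hkl <;> split at hkl
      · have := hxi _ _ (by omega) (by omega) (by omega) (by omega) hkl
        lia
      · exact absurd hkl (hne _)
      · exact absurd hkl.symm (hne _)
      · lia
  have hbij : Function.Bijective f := by
    rw [Fintype.bijective_iff_injective_and_card]
    refine ⟨hinj, ?_⟩
    rw [Fintype.card_sum, Fintype.card_fin, Fintype.card_fin]
    lia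
  have e1 : ∀ k : ℤ, Even (2 * k) := fun k => even_two_mul k
  have e2 : ∀ k : ℤ, Odd (2 * k + 1) := fun k => odd_two_mul_add_one k
  have e3 : ∀ k : ℤ, ¬ Even (2 * k + 1) := fun k => Int.not_even_iff_odd.2 (e2 k)
  refine ⟨RelIso.symm ⟨Equiv.ofBijective f hbij, ?_⟩⟩
  rintro (k | k) (l | l) <;> simp only [Equiv.ofBijective_apply, f, Sum.elim_inl, Sum.elim_inr,
    completeBipartiteGraph_Adj, Sum.isLeft_inl, Sum.isRight_inl, Sum.isLeft_inr, Sum.isRight_inr]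
  · simpa using h.not_adj_of_even hD hev he hem hno (e1 k) (e1 l)
  · split
    · simp [(hodd (e2 l)).2, e1]
    · simp [hyin, e1]
  · split
    · simp [(hodd (e2 k)).1, e1]
    · simp [hev, e1]
  · split <;> split
    · simp [(hodd (e2 k)).1]
    · simp [hyin]
    · simp [hev]
    · simpa using hD.loopless y

end Bipartite

end Digraph

/-! ### Cycle lengths and the complement of a longest cycle -/

open Digraph in
theorem mainTheorem2 {V : Type*} [Fintype V] (D : Digraph V) (p m : ℕ)
    (hloop : D.Loopless)
    (hp : Fintype.card V = p)
    (hstrong : D.StronglyConnected)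
    (hnonham : ¬ D.IsHamiltonian)
    (hdeg : ∀ x, p - 1 ≤ D.degree x)
    (hm : IsGreatest {k | D.HasCycleOfLength k} m) :
    (¬ (Odd p ∧ D.Isomorphic
          (Digraph.completeBipartiteGraph (Fin (p / 2)) (Fin (p / 2 + 1)))) →
      ∀ r ∈ Set.Icc 2 m, D.HasCycleOfLength r) ∧
    (D.KStronglyConnected 2 →
      ∀ C : Cycle V, D.IsLongestCycle C →
        (D.induce {x | x ∉ C}).IsTransitiveTournament) := by
  classical
  subst hp
  have hdeg' : ∀ v, Fintype.card V ≤ D.degOn v Finset.univ + 1 := fun v => by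
    have := hdeg v
    rw [degree_eq_degOn] at this
    lia
  have hmax : ∀ k, D.HasCycleOfLength k → k ≤ m := fun k hk => hm.2 hk
  constructor
  · rintro hiso r ⟨hr, hrm⟩
    obtain ⟨C, hC, hCm⟩ := hm.1
    obtain ⟨x, hc, hCx⟩ := hC.exists_isCyc
    rw [hCm] at hc
    obtain ⟨y₀, hy₀⟩ : ∃ y, y ∉ Set.range x := by
      by_contra! hcon
      exact hnonham ⟨C, hC, fun v => (hCx v).2 (hcon v)⟩
    by_cases hby : ∃ y, y ∉ Set.range x ∧ D.OnBypass m x y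
    · obtain ⟨y, hy, hby⟩ := hby
      obtain ⟨i, g, hg, hgm, hi, hig, hmin⟩ := hby.exists_min hc
      obtain ⟨T, hyT, hT, -, -, htw⟩ :=
        exists_twinBlocks hloop hdeg' hc hmax hy hg hgm hi hig hmin
      by_cases hT2 : 2 ≤ T.card
      · exact htw.hasCycle hT2 hr hrm
      have hTpos := Finset.card_pos.2 ⟨y, hyT⟩
      obtain ⟨y', hTy⟩ := Finset.card_eq_one.1 (show T.card = 1 by lia)
      rw [hTy, Finset.mem_singleton] at hyT
      subst hyT
      obtain rfl : g = 2 := by rw [hTy] at hT; simp at hT; lia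
      have hD : D.IsCritical m := ⟨hloop, hdeg', hmax, by lia⟩
      by_contra hno
      have hym : y ∈ T ∪ seg x (i + 1) (i + 2 - 1) := by simp [hTy]
      -- shift the indices so that `y` can replace the vertex at the position `-1`
      have hub : D.IsHub m (fun k => x (k + (i + 2))) y := by
        have hA : D.Adj (x (i + 1 - 1)) y := by
          have := htw.from_last y hym
          rwa [hc.add_period, ← add_sub_cancel_right i 1] at this
        have hB : D.Adj y (x (i + 1 + 1)) := by
          have := htw.to_first y hym
          rwa [show i + 1 + 1 = i + 2 by ring]
        have htw1 := hD.twinBlocks hc hy hA hB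
        refine ⟨hc.shift _, ?_, ?_⟩
        · rintro ⟨k, hk⟩; exact hy ⟨_, hk⟩
        · intro k
          have := htw1.splits hc (k + (i + 2))
          rwa [add_right_comm] at this
      have n1 : ¬ D.Adj y (x (-1 + (i + 2))) :=
        (htw.not_adj y (by simp [hTy]) _ (mem_seg_of (by lia) (by lia))).1
      have n2 : D.Adj y (x (0 + (i + 2))) := by
        rw [zero_add]; exact htw.to_first y hym
      have hr1 : r - 1 + 1 = r := by lia
      obtain ⟨he, x', y', hub', hev⟩ := hub.exists_even hD n1 n2 (e := r - 1) (by lia) (by lia)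
        (by rwa [hr1])
      exact hiso (hub'.isomorphic hD hstrong hev he (by lia) (by rwa [hr1]))
    · push Not at hby
      exact hasCycle_of_not_onBypass hloop hdeg' hstrong hc hy₀ hby hr hrm
  · intro h2 C hC
    have hCm : C.length = m :=
      le_antisymm (hmax _ ⟨C, hC.1, rfl⟩) (by
        obtain ⟨C', hC', hC'm⟩ := hm.1
        exact hC'm ▸ hC.2 C' hC')
    obtain ⟨x, hc, hCx⟩ := hC.1.exists_isCyc
    rw [hCm] at hc
    -- every strong component outside the cycle is a single vertex with one arc to any other one
    have key : ∀ y, y ∉ Set.range x → (∀ z, z ∉ Set.range x → z ≠ y →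
        Xor (D.Adj y z) (D.Adj z y)) ∧ ∀ z, z ∉ Set.range x →
          D.WalkIn (Set.range x)ᶜ y z → D.WalkIn (Set.range x)ᶜ z y → z = y := by
      intro y hy
      obtain ⟨i, g, hg, hgm, hi, hig, hmin⟩ := (h2.onBypass hc hy).exists_min hc
      obtain ⟨T, hyT, -, hTx, hTcomp, htw⟩ :=
        exists_twinBlocks hloop hdeg' hc hmax hy hg hgm hi hig hmin
      have hTpos := Finset.card_pos.2 ⟨y, hyT⟩
      have hT1 : T.card = 1 := by
        by_contra hT1
        exact htw.not_kStronglyConnected (by lia) h2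
      obtain ⟨y', rfl⟩ := Finset.card_eq_one.1 hT1
      rw [Finset.mem_singleton] at hyT
      subst hyT
      refine ⟨fun z hz hzy => ?_, fun z hz h1 h2 => by simpa using hTcomp z hz h1 h2⟩
      have hzU : z ∉ {y} ∪ seg x (i + 1) (i + g - 1) ∪ seg x (i + g) (i + m) := by
        simp only [Finset.mem_union, Finset.mem_singleton, mem_seg, not_or]
        exact ⟨⟨hzy, fun ⟨k, _, _, hk⟩ => hz ⟨k, hk⟩⟩, fun ⟨k, _, _, hk⟩ => hz ⟨k, hk⟩⟩
      exact (htw.outside z hzU).imp (fun ho => ho y (by simp)) fun ho => ho y (by simp)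
    have hout : ∀ u : {v | v ∉ C}, u.1 ∉ Set.range x := fun u => by
      rw [← hCx]; exact u.2
    refine ⟨⟨fun u => hloop u, fun u v huv => ?_⟩, fun u v w huv hvw => ?_⟩
    · exact (key u (hout u)).1 v (hout v) fun h => huv (Subtype.ext h.symm)
    · have huv' : D.Adj u v := huv
      have hvw' : D.Adj v w := hvw
      have hwu : (w : V) ≠ u := fun h => by
        have hvu : (v : V) ≠ u := fun h => hloop u (h ▸ huv')
        have := (key u (hout u)).1 v (hout v) hvu
        rw [h] at hvw'
        unfold Xor at this
        tauto
      rcases (key u (hout u)).1 w (hout w) hwu with ⟨huw, -⟩ | ⟨hwu', -⟩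
      · exact huw
      · exact absurd ((key u (hout u)).2 v (hout v) (.arc (hout u) (hout v) huv')
          (WalkIn.trans (.arc (hout v) (hout w) hvw') (.arc (hout w) (hout u) hwu')))
          fun h => hloop u (h ▸ huv')
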